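/- Let $M,n,m,n_w,p_u,p_y$ be given dimensions and consider the system $x_{t+1}=Ax_t+Bu_t+B_w w_t$, $t=0,\dots,M-1$, with $x_t\in\mathbb R^n$, $u_t\in\mathbb R^m$, $w_t\in\mathbb R^{n_w}$, fixed initial state $x_0$, and disturbance feedback inputs $$u_t=\gamma_t+\sum_{\tau=0}^{t-1}\theta_{t,\tau}w_\tau ,\qquad \gamma_t\in\mathbb R^m,\ \theta_{t,\tau}\in\mathbb R^{m\times n_w}.$$ Let $\lambda$ collect all $\gamma_t$ ($0\le t<M$) and $\theta_{t,\tau}$ ($0\le\tau<t<M$). Write $\mathbf w=(w_0,\dots,w_{M-1})$, and let $\mathbf u(\mathbf w,\lambda)=(u_0,\dots,u_{M-1})$ and $\mathbf x(\mathbf w,\lambda)=(x_1,\dots,x_M)$ be the resulting inputs and states. Let $\mathbb P$ be an arbitrary probability distribution of $\mathbf w$ on $\mathbb R^{n_wM}$. Let $f:\mathbb R^{mM}\to\mathbb R^{p_u}$ and $g:\mathbb R^{(n+m)M}\to\mathbb R^{p_y}$ be continuous with convex components, and let $L:\mathbb R^{p_y}\to\mathbb R$ and $J=J(\lambda)$ be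 strictly convex. Vector inequalities are componentwise. Given $N\ge 1$ independent draws $\mathbf w^{(1)},\dots,\mathbf w^{(N)}$ from $\mathbb P$, a pair $(\lambda^\star,h^\star)$ is a solution of the scenario cascade if $h^\star$ is the $h$-component of a minimizer of $$\min_{\lambda,h} L(h)\quad\text{s.t. } f(\mathbf u(\mathbf w^{(k)},\lambda))\le 0,\ \ g(\mathbf x(\mathbf w^{(k)},\lambda),\mathbf u(\mathbf w^{(k)},\lambda))\le h,\ k=1,\dots,N,\ \ h\ge 0,$$ and $\lambda^\star$ is a minimizer of $$\min_{\lambda} J(\lambda)\quad\text{s.t. } f(\mathbf u(\mathbf w^{(k)},\lambda))\le 0,\ \ g(\mathbf x(\mathbf w^{(k)},\lambda),\mathbf u(\mathbf w^{(k)},\lambda))\le h^\star,\ k=1,\dots,N.$$ Let $\epsilon,\beta\in(0,1)$, let $d$ be the dimension of $(\lambda,h)$, and suppose $$\sum_{i=0}^{d-1}\binom Ni\epsilon^i(1-\epsilon)^{N-i}\le\beta .$$ Then for every sample the cascade has at most one solution $(\lambda^\star,h^\star)$, and with confidence at least $1-\beta$ the solution satisfies $$\mathbb P\{f(\mathbf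 u(\mathbf w,\lambda^\star))\le 0\ \wedge\ g(\mathbf x(\mathbf w,\lambda^\star),\mathbf u(\mathbf w,\lambda^\star))\le h^\star\}\ge 1-\epsilon .$$ Precisely: the $\mathbb P^N$-probability (outer probability) of the samples for which a solution exists and violates this chance constraint is at most $\beta$; consequently, if a solution exists for $\mathbb P^N$-almost every sample, then the probability that it exists and satisfies the chance constraint is at least $1-\beta$. -/

import Mathlib

open MeasureTheory

/-- Design parameters `lam = (γ, θ)` of the disturbance feedback policy over the horizon `M`:
the open-loop terms `γ_t ∈ ℝ^m` for `t < M` and the gains `θ_{t,τ} ∈ ℝ^{m × nw}` for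
`τ < t < M`. -/
abbrev PolicyParam (M m nw : ℕ) : Type :=
  (Fin M → Fin m → ℝ) × ((t : Fin M) → Fin t → Matrix (Fin m) (Fin nw) ℝ)

/-- The policy `u_t = γ_t + ∑_{τ < t} θ_{t,τ} w_τ`, stacked over `t < M`. -/
noncomputable def PolicyParam.input {M m nw : ℕ} (lam : PolicyParam M m nw)
    (w : Fin M → Fin nw → ℝ) : Fin M → Fin m → ℝ :=
  fun t => lam.1 t + ∑ τ : Fin t, (lam.2 t τ).mulVec (w ⟨τ, τ.isLt.trans t.isLt⟩)

/-- The data of the constrained finite-horizon control problem: the system matrices and the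
initial state, the input constraint function `f`, the joint state and input constraint
function `g`, the relaxation cost `L` and the performance cost `J`. -/
structure ControlProblem (M n m nw pu py : ℕ) where
  A : Matrix (Fin n) (Fin n) ℝ
  B : Matrix (Fin n) (Fin m) ℝ
  Bw : Matrix (Fin n) (Fin nw) ℝ
  x0 : Fin n → ℝ
  f : (Fin M → Fin m → ℝ) → Fin pu → ℝ
  g : (Fin M → Fin n → ℝ) × (Fin M → Fin m → ℝ) → Fin py → ℝ
  L : (Fin py → ℝ) → ℝ
  J : PolicyParam M m nw → ℝ

namespace ControlProblem

variable {M n m nw pu py : ℕ}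

/-- The state `x_t`, `t ≤ M`, of `x_{t+1} = A x_t + B u_t + B_w w_t` started at `x_0`. -/
noncomputable def stateAt (C : ControlProblem M n m nw pu py)
    (u : Fin M → Fin m → ℝ) (w : Fin M → Fin nw → ℝ) : (t : ℕ) → t ≤ M → Fin n → ℝ
  | 0, _ => C.x0
  | t + 1, h => C.A.mulVec (stateAt C u w t (Nat.le_of_succ_le h))
      + C.B.mulVec (u ⟨t, h⟩) + C.Bw.mulVec (w ⟨t, h⟩)

/-- The stacked states `(x_1, …, x_M)` under the policy with parameters `lam`. -/
noncomputable def states (C : ControlProblem M n m nw pu py)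
    (w : Fin M → Fin nw → ℝ) (lam : PolicyParam M m nw) : Fin M → Fin n → ℝ :=
  fun t => C.stateAt (lam.input w) w (t + 1) t.isLt

/-- `f(u(w, lam)) ≤ 0 ∧ g(x(w, lam), u(w, lam)) ≤ h`, componentwise. -/
def Satisfies (C : ControlProblem M n m nw pu py)
    (w : Fin M → Fin nw → ℝ) (lam : PolicyParam M m nw) (h : Fin py → ℝ) : Prop :=
  C.f (lam.input w) ≤ 0 ∧ C.g (C.states w lam, lam.input w) ≤ h

/-- The chance constraint: under `P` the constraints hold with probability at least `1 - ε`. -/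
def ChanceConstraint (C : ControlProblem M n m nw pu py)
    (P : Measure (Fin M → Fin nw → ℝ)) (ε : ℝ)
    (lam : PolicyParam M m nw) (h : Fin py → ℝ) : Prop :=
  1 - ε ≤ P.real {w | C.Satisfies w lam h}

/-- Feasible set of the first scenario program, in the variables `(lam, h)`. -/
def feasibleOne (C : ControlProblem M n m nw pu py) {N : ℕ}
    (ω : Fin N → Fin M → Fin nw → ℝ) : Set (PolicyParam M m nw × (Fin py → ℝ)) :=
  {p | (∀ k, C.Satisfies (ω k) p.1 p.2) ∧ 0 ≤ p.2}

/-- Feasible set of the second scenario program, in the variable `lam`, with bound `h` fixed. -/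
def feasibleTwo (C : ControlProblem M n m nw pu py) {N : ℕ}
    (ω : Fin N → Fin M → Fin nw → ℝ) (h : Fin py → ℝ) : Set (PolicyParam M m nw) :=
  {lam | ∀ k, C.Satisfies (ω k) lam h}

/-- `h` is an optimal value of the variable `h` in the first scenario program, which minimizes
`L(h)` over `(lam, h)`. -/
def IsStageOneOptimal (C : ControlProblem M n m nw pu py) {N : ℕ}
    (ω : Fin N → Fin M → Fin nw → ℝ) (h : Fin py → ℝ) : Prop :=
  ∃ lam, (lam, h) ∈ C.feasibleOne ω ∧ IsMinOn (fun p => C.L p.2) (C.feasibleOne ω) (lam, h)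

/-- `p = (lam, h)` solves the scenario cascade: `h` is optimal for the first program, and `lam`
minimizes `J` over the second program with that `h`. -/
def IsCascadeSolution (C : ControlProblem M n m nw pu py) {N : ℕ}
    (ω : Fin N → Fin M → Fin nw → ℝ) (p : PolicyParam M m nw × (Fin py → ℝ)) : Prop :=
  C.IsStageOneOptimal ω p.2 ∧ p.1 ∈ C.feasibleTwo ω p.2 ∧ IsMinOn C.J (C.feasibleTwo ω p.2) p.1

end ControlProblem

/-!
A cascade solution is the optimal point of a two-stage convex program in the `d` variables
`(λ, h)`: minimize `L h`, and among the minimizers minimize `J λ`. Strict convexity of `L` and of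
`J` makes it unique (`ControlProblem.IsCascadeSolution.lex`). Whenever some input sequence satisfies
`f ≤ 0`, applying it in open loop and taking `h` large satisfies any finite number of scenarios, so
every finite program is feasible (`ControlProblem.exists_violation_nonpos`); otherwise no sample has
a solution.

The tail bound is first proved for one strictly convex coercive cost and for *nondegenerate*
programs, those in which a fixed point almost never makes the constraint of a random scenario
active. By Helly's theorem a subfamily of scenarios all of which matter for its optimal point has at
most `d` members (`ConvexScenario.card_le_finrank_of_mem_essential`). Nondegeneracy makes the
subfamily determining the optimal point of a sample, its basis, almost surely unique
(`ConvexScenario.basisEvent_unique`). Let `Fᵢ` be the law of the probability `t` that a random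
scenario is satisfied at the optimal point of `i` random scenarios, restricted to the event that
all of them matter. Splitting according to the basis of the sample of size `n` gives
`ℙ(t ∈ B) = ∑ i ≤ d, (n choose i) ∫_B t ^ (n - i) dFᵢ` (`ConvexScenario.real_satProb_mem`). With `B`
everything, the right side is `1` for every `n ≥ d`, and these moment identities alone bound the
tail by the binomial one (`sum_choose_mul_setIntegral_le_binomial_tail`). Indeed the normalised
primitive of level `i + 1` of the family `(n choose i) t ^ (n - i)` is level `i`, so the sum over
the levels of the integrals of the iterated primitives of a function `h` is the top primitive of `h`
evaluated at `1`: for monomials by the identities, for polynomials by linearity. Polynomials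
approximating a cutoff of `(n choose d) t ^ (n - d)` at `1 - ε` from above then give the bound.

Degenerate programs are limits of nondegenerate ones: each scenario receives an independent uniform
label `s`, its constraint is relaxed by `ρ |s|`, and `ρ → 0` (`ConvexScenario.relax`). Two-stage
costs `ℓ`, `b` are limits of `ℓ + δ (b + η ‖·‖²)`, first as `δ → 0`, then as `η → 0`; the quadratic
penalty makes optimal points exist even for samples whose cascade has no solution. In all three
limits the optimal points converge for each sample at which the limiting program has one, and since
the constraint sets are closed, a violation probability above `ε` persists along the sequence.
Fatou's lemma for sets, valid for outer measures, transfers the bound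
(`measure_le_of_forall_eventually_mem`).
-/

open Filter Set Topology

/-! ### Normalised iterated primitives -/

/-- The `k`-fold primitive `(i+1)(i+2)⋯(i+k) ∫₀ᵗ∫₀⋯∫₀ h` from `0`, with the factors assigned so
that level `i + k` of the family `j ↦ (n choose j) t ^ (n - j)` is carried to level `i`. -/
noncomputable def iterPrim : ℕ → ℕ → (ℝ → ℝ) → ℝ → ℝ
  | _, 0, h => h
  | i, k + 1, h => fun t => (i + 1) * ∫ s in (0 : ℝ)..t, iterPrim (i + 1) k h s

theorem continuous_iterPrim {h : ℝ → ℝ} (hh : Continuous h) (i k : ℕ) :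
    Continuous (iterPrim i k h) := by
  induction k generalizing i with
  | zero => exact hh
  | succ k ih =>
    exact continuous_const.mul
      (intervalIntegral.continuous_primitive (fun a b => (ih (i + 1)).intervalIntegrable a b) 0)

theorem iterPrim_add {g h : ℝ → ℝ} (hg : Continuous g) (hh : Continuous h) (i k : ℕ) :
    iterPrim i k (fun t => g t + h t) = fun t => iterPrim i k g t + iterPrim i k h t := by
  induction k generalizing i with
  | zero => rfl
  | succ k ih =>
    funext t
    simp only [iterPrim, ih]
    rw [intervalIntegral.integral_add ((continuous_iterPrim hg _ _).intervalIntegrable _ _)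
      ((continuous_iterPrim hh _ _).intervalIntegrable _ _)]
    ring

theorem iterPrim_const_mul (c : ℝ) (h : ℝ → ℝ) (i k : ℕ) :
    iterPrim i k (fun t => c * h t) = fun t => c * iterPrim i k h t := by
  induction k generalizing i with
  | zero => rfl
  | succ k ih =>
    funext t
    simp only [iterPrim, ih, intervalIntegral.integral_const_mul]
    ring

theorem iterPrim_mono {g h : ℝ → ℝ} (hg : Continuous g) (hh : Continuous h) {b : ℝ}
    (hgh : ∀ t ∈ Set.Icc 0 b, g t ≤ h t) (i k : ℕ) :
    ∀ t ∈ Set.Icc 0 b, iterPrim i k g t ≤ iterPrim i k h t := by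
  induction k generalizing i with
  | zero => exact hgh
  | succ k ih =>
    intro t ht
    simp only [iterPrim]
    refine mul_le_mul_of_nonneg_left ?_ (by positivity)
    exact intervalIntegral.integral_mono_on ht.1
      ((continuous_iterPrim hg _ _).intervalIntegrable _ _)
      ((continuous_iterPrim hh _ _).intervalIntegrable _ _)
      (fun s hs => ih (i + 1) s ⟨hs.1, hs.2.trans ht.2⟩)

theorem iterPrim_choose_mul_pow {n : ℕ} (i k : ℕ) (hn : i + k ≤ n) :
    iterPrim i k (fun t => (n.choose (i + k) : ℝ) * t ^ (n - (i + k))) =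
      fun t => (n.choose i : ℝ) * t ^ (n - i) := by
  induction k generalizing i with
  | zero => rfl
  | succ k ih =>
    funext t
    have h1 := ih (i + 1) (by omega)
    rw [show i + 1 + k = i + (k + 1) by ring] at h1
    simp only [iterPrim, h1, intervalIntegral.integral_const_mul, integral_pow]
    have h2 : n - (i + 1) + 1 = n - i := by omega
    have h3 : (n.choose (i + 1) : ℝ) * (i + 1) = n.choose i * ((n - i : ℕ) : ℝ) := by
      exact_mod_cast Nat.choose_succ_right_eq n i
    have h4 : (((n - (i + 1) : ℕ) : ℝ) + 1) = ((n - i : ℕ) : ℝ) := by exact_mod_cast h2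
    have h5 : ((n - i : ℕ) : ℝ) ≠ 0 := by
      have : n - i ≠ 0 := by omega
      exact_mod_cast this
    rw [h2, h4, zero_pow (by omega)]
    field_simp
    linear_combination t ^ (n - i) * h3

/-- Taylor expansion at `σ` bounds the iterated primitive of a truncated monomial. -/
theorem iterPrim_le_of_le_zero {h : ℝ → ℝ} (hh : Continuous h) {n : ℕ} {σ : ℝ} (hσ : 0 ≤ σ)
    (i k : ℕ) (hn : i + k ≤ n)
    (h1 : ∀ t ∈ Set.Icc 0 σ, h t ≤ (n.choose (i + k) : ℝ) * t ^ (n - (i + k)))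
    (h2 : ∀ t, σ ≤ t → h t ≤ 0) (t : ℝ) (ht : σ ≤ t) :
    iterPrim i k h t ≤ ∑ l ∈ Finset.range k,
      ((i + l).choose i : ℝ) * n.choose (i + l) * σ ^ (n - (i + l)) * (t - σ) ^ l := by
  induction k generalizing i t with
  | zero => simpa [iterPrim] using h2 t ht
  | succ k ih =>
    have hi : i + 1 + k = i + (k + 1) := by ring
    have hint : ∀ a b, IntervalIntegrable (iterPrim (i + 1) k h) volume a b :=
      fun a b => (continuous_iterPrim hh _ _).intervalIntegrable a b
    have e1 : iterPrim i (k + 1) h σ ≤ n.choose i * σ ^ (n - i) := by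
      have := iterPrim_mono hh (by fun_prop) h1 i (k + 1) σ ⟨hσ, le_rfl⟩
      rwa [iterPrim_choose_mul_pow i (k + 1) hn] at this
    have e2 : iterPrim i (k + 1) h t =
        iterPrim i (k + 1) h σ + (i + 1) * ∫ s in σ..t, iterPrim (i + 1) k h s := by
      simp only [iterPrim]
      rw [← intervalIntegral.integral_add_adjacent_intervals (hint 0 σ) (hint σ t)]
      ring
    have e3 : ∫ s in σ..t, iterPrim (i + 1) k h s ≤ ∫ s in σ..t, ∑ l ∈ Finset.range k,
        ((i + 1 + l).choose (i + 1) : ℝ) * n.choose (i + 1 + l) * σ ^ (n - (i + 1 + l)) *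
          (s - σ) ^ l := by
      refine intervalIntegral.integral_mono_on ht (hint _ _)
        (Continuous.intervalIntegrable (by fun_prop) _ _) (fun s hs => ?_)
      exact ih (i + 1) (by omega) (by rwa [hi]) s hs.1
    have e4 : (i + 1) * ∫ s in σ..t, ∑ l ∈ Finset.range k,
        ((i + 1 + l).choose (i + 1) : ℝ) * n.choose (i + 1 + l) * σ ^ (n - (i + 1 + l)) *
          (s - σ) ^ l = ∑ l ∈ Finset.range k, ((i + (l + 1)).choose i : ℝ) *
            n.choose (i + (l + 1)) * σ ^ (n - (i + (l + 1))) * (t - σ) ^ (l + 1) := by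
      rw [intervalIntegral.integral_finsetSum
        (fun l _ => Continuous.intervalIntegrable (by fun_prop) _ _), Finset.mul_sum]
      refine Finset.sum_congr rfl fun l _ => ?_
      rw [intervalIntegral.integral_const_mul,
        intervalIntegral.integral_comp_sub_right (fun s => s ^ l) σ, sub_self, integral_pow,
        zero_pow (by omega), show i + 1 + l = i + (l + 1) by ring]
      have h3 : ((i + (l + 1)).choose (i + 1) : ℝ) * (i + 1) =
          (i + (l + 1)).choose i * ((l : ℝ) + 1) := by
        have := Nat.choose_succ_right_eq (i + (l + 1)) i
        rw [Nat.add_sub_cancel_left] at this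
        exact_mod_cast this
      field_simp
      linear_combination (t - σ) ^ (l + 1) * σ ^ (n - (i + (l + 1))) * n.choose (i + (l + 1)) * h3
    rw [Finset.sum_range_succ', e2, ← e4]
    have := mul_le_mul_of_nonneg_left e3 (by positivity : (0 : ℝ) ≤ (i : ℝ) + 1)
    simp only [add_zero, Nat.choose_self, Nat.cast_one, one_mul, pow_zero, mul_one]
    linarith

/-! ### A moment problem with binomial tail -/

/-- Integration of all levels `i ≤ d` of the iterated primitives of `h`. -/
noncomputable def levelIntegral (d : ℕ) (F : ℕ → Measure ℝ) (h : ℝ → ℝ) : ℝ :=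
  ∑ i ∈ Finset.range (d + 1), ∫ t, iterPrim i (d - i) h t ∂F i

theorem integrable_of_continuous_of_ae_mem_Icc {F : Measure ℝ} [IsFiniteMeasure F]
    (hF : ∀ᵐ t ∂F, t ∈ Set.Icc (0 : ℝ) 1) {h : ℝ → ℝ} (hh : Continuous h) : Integrable h F := by
  obtain ⟨C, hC⟩ := isCompact_Icc.exists_bound_of_continuousOn (s := Set.Icc (0 : ℝ) 1)
    hh.continuousOn
  exact Integrable.of_bound hh.aestronglyMeasurable C (hF.mono fun t ht => hC t ht)

/-- If the moment identities hold, `levelIntegral` is evaluation of the top primitive at `1`, on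
polynomials. -/
theorem levelIntegral_polynomial {d : ℕ} {F : ℕ → Measure ℝ} [∀ i, IsFiniteMeasure (F i)]
    (hF : ∀ i, ∀ᵐ t ∂F i, t ∈ Set.Icc (0 : ℝ) 1)
    (hmom : ∀ n, d ≤ n →
      ∑ i ∈ Finset.range (d + 1), (n.choose i : ℝ) * ∫ t, t ^ (n - i) ∂F i = 1)
    (p : Polynomial ℝ) :
    levelIntegral d F (fun t => p.eval t) = iterPrim 0 d (fun t => p.eval t) 1 := by
  induction p using Polynomial.induction_on' with
  | add p q hp hq =>
    have hpc : Continuous fun t => p.eval t := p.continuous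
    have hqc : Continuous fun t => q.eval t := q.continuous
    simp only [Polynomial.eval_add, iterPrim_add hpc hqc, ← hp, ← hq, levelIntegral]
    rw [← Finset.sum_add_distrib]
    refine Finset.sum_congr rfl fun i _ => ?_
    exact integral_add
      (integrable_of_continuous_of_ae_mem_Icc (hF i) (continuous_iterPrim hpc _ _))
      (integrable_of_continuous_of_ae_mem_Icc (hF i) (continuous_iterPrim hqc _ _))
  | monomial m a =>
    have key : levelIntegral d F (fun t => ((m + d).choose d : ℝ) * t ^ m) =
        iterPrim 0 d (fun t => ((m + d).choose d : ℝ) * t ^ m) 1 := by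
      have h0 : ∀ i, i ≤ d → iterPrim i (d - i) (fun t => ((m + d).choose d : ℝ) * t ^ m) =
          fun t => ((m + d).choose i : ℝ) * t ^ (m + d - i) := by
        intro i hi
        have := iterPrim_choose_mul_pow (n := m + d) i (d - i) (by omega)
        rwa [show i + (d - i) = d by omega, Nat.add_sub_cancel] at this
      have h1 := h0 0 (by omega)
      rw [Nat.sub_zero] at h1
      rw [h1, levelIntegral, Finset.sum_congr rfl fun i hi => by
        rw [h0 i (by simpa [Nat.lt_succ_iff] using hi), integral_const_mul], hmom _ (by omega)]
      simp
    have hc : ((m + d).choose d : ℝ) ≠ 0 := by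
      exact_mod_cast (Nat.choose_pos (Nat.le_add_left d m)).ne'
    have e : (fun t : ℝ => (Polynomial.monomial m a).eval t) =
        fun t => (a / (m + d).choose d) * (((m + d).choose d : ℝ) * t ^ m) := by
      funext t
      rw [Polynomial.eval_monomial]
      field_simp
    rw [e]
    simp only [iterPrim_const_mul _ (fun t => ((m + d).choose d : ℝ) * t ^ m), ← key,
      levelIntegral, integral_const_mul, Finset.mul_sum]

/-- The moment identities determine the tails: whatever the number of levels carrying mass, the
tail is at most the binomial one, which is attained when only level `d` carries mass. -/
theorem sum_choose_mul_setIntegral_le_binomial_tail {d : ℕ} {F : ℕ → Measure ℝ}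
    [∀ i, IsFiniteMeasure (F i)] (hF : ∀ i, ∀ᵐ t ∂F i, t ∈ Set.Icc (0 : ℝ) 1)
    (hmom : ∀ n, d ≤ n →
      ∑ i ∈ Finset.range (d + 1), (n.choose i : ℝ) * ∫ t, t ^ (n - i) ∂F i = 1)
    {n : ℕ} (hn : d ≤ n) {τ : ℝ} (hτ0 : 0 < τ) (hτ1 : τ < 1) :
    ∑ i ∈ Finset.range (d + 1), (n.choose i : ℝ) * ∫ t in Set.Iio τ, t ^ (n - i) ∂F i ≤
      ∑ i ∈ Finset.range d, (n.choose i : ℝ) * (1 - τ) ^ i * τ ^ (n - i) := by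
  -- First compare with the tail at a slightly larger threshold `σ`, which leaves room for a
  -- continuous cutoff between `τ` and `σ` and for a polynomial approximation of it.
  have main : ∀ σ, τ < σ → σ < 1 → ∀ η > 0,
      ∑ i ∈ Finset.range (d + 1), (n.choose i : ℝ) * ∫ t in Set.Iio τ, t ^ (n - i) ∂F i ≤
      ∑ i ∈ Finset.range d, (n.choose i : ℝ) * (1 - σ) ^ i * σ ^ (n - i) + 2 * η := by
    intro σ hσ hσ1 η hη
    set χ : ℝ → ℝ := fun t => max 0 (min 1 ((σ - t) / (σ - τ))) with hχ
    have hχc : Continuous χ := by fun_prop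
    have hpos : 0 < σ - τ := sub_pos.2 hσ
    have hχ0 : ∀ t, 0 ≤ χ t := fun t => le_max_left _ _
    have hχ1 : ∀ t, χ t ≤ 1 := fun t => max_le zero_le_one (min_le_left _ _)
    have hχτ : ∀ t, t ≤ τ → χ t = 1 := by
      intro t ht
      have : 1 ≤ (σ - t) / (σ - τ) := by rw [le_div_iff₀ hpos]; linarith
      simp [hχ, this]
    have hχσ : ∀ t, σ ≤ t → χ t = 0 := by
      intro t ht
      have : (σ - t) / (σ - τ) ≤ 0 := div_nonpos_of_nonpos_of_nonneg (by linarith) hpos.le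
      simp [hχ, this]
    set h : ℝ → ℝ := fun t => (n.choose d : ℝ) * t ^ (n - d) * χ t with hh
    have hhc : Continuous h := by fun_prop
    obtain ⟨p, hp⟩ := exists_polynomial_near_of_continuousOn 0 1 (fun t => h t + η)
      (by fun_prop) η hη
    have hp1 : ∀ t ∈ Set.Icc (0 : ℝ) 1, h t ≤ p.eval t := fun t ht => by
      have := (abs_lt.1 (hp t ht)).1; linarith
    have hp2 : ∀ t ∈ Set.Icc (0 : ℝ) 1, p.eval t ≤ h t + 2 * η := fun t ht => by
      have := (abs_lt.1 (hp t ht)).2; linarith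
    have hpc : Continuous fun t => p.eval t := p.continuous
    -- the left side is at most `levelIntegral` of the polynomial
    have step1 : ∑ i ∈ Finset.range (d + 1),
        (n.choose i : ℝ) * ∫ t in Set.Iio τ, t ^ (n - i) ∂F i ≤
        levelIntegral d F (fun t => p.eval t) := by
      refine Finset.sum_le_sum fun i hi => ?_
      have hid : i ≤ d := by simpa [Nat.lt_succ_iff] using hi
      rw [← integral_const_mul, ← integral_indicator measurableSet_Iio]
      have hmon : Continuous fun t : ℝ => (n.choose i : ℝ) * t ^ (n - i) := by fun_prop
      refine integral_mono_ae
        ((integrable_of_continuous_of_ae_mem_Icc (hF i) hmon).indicator measurableSet_Iio)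
        (integrable_of_continuous_of_ae_mem_Icc (hF i) (continuous_iterPrim hpc _ _)) ?_
      filter_upwards [hF i] with t ht
      have hle := iterPrim_mono hhc hpc hp1 i (d - i) t ht
      by_cases htτ : t < τ
      · rw [Set.indicator_of_mem (by simpa using htτ)]
        have := iterPrim_mono (b := t)
          (g := fun t => (n.choose (i + (d - i)) : ℝ) * t ^ (n - (i + (d - i)))) (h := h)
          (by fun_prop) hhc (fun s hs => by
            rw [hh, show i + (d - i) = d by omega]
            simp [hχτ s (hs.2.trans htτ.le)]) i (d - i) t ⟨ht.1, le_rfl⟩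
        rw [iterPrim_choose_mul_pow i (d - i) (by omega)] at this
        exact this.trans hle
      · rw [Set.indicator_of_notMem (by simpa using htτ)]
        have := iterPrim_mono (b := 1) (g := fun _ => 0 * (0 : ℝ)) (h := h)
          (by fun_prop) hhc (fun s hs => by
            rw [hh, zero_mul]
            have := hχ0 s
            have := pow_nonneg hs.1 (n - d)
            positivity) i (d - i) t ht
        rw [iterPrim_const_mul] at this
        simp only [zero_mul] at this
        exact this.trans hle
    rw [levelIntegral_polynomial hF hmom] at step1
    have h1mem : (1 : ℝ) ∈ Set.Icc (0 : ℝ) 1 := ⟨zero_le_one, le_rfl⟩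
    have step2 : iterPrim 0 d (fun t => p.eval t) 1 ≤ iterPrim 0 d h 1 + 2 * η := by
      have h1 := iterPrim_mono hpc (by fun_prop) hp2 0 d 1 h1mem
      rw [iterPrim_add hhc continuous_const] at h1
      have h2 : iterPrim 0 d (fun _ => 2 * η) 1 = 2 * η := by
        have h3 := iterPrim_choose_mul_pow (n := d) 0 d (by omega)
        have h4 := iterPrim_const_mul (2 * η) (fun _ => 1) 0 d
        simp only [zero_add, Nat.choose_self, Nat.cast_one, one_mul, Nat.sub_self, pow_zero,
          Nat.choose_zero_right, Nat.sub_zero, mul_one] at h3 h4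
        rw [h4, h3]
        simp
      linarith
    have step3 := iterPrim_le_of_le_zero hhc (n := n) (σ := σ) (by linarith) 0 d (by omega)
      (fun t ht => by
        rw [zero_add, hh]
        have := pow_nonneg ht.1 (n - d)
        exact mul_le_of_le_one_right (by positivity) (hχ1 t))
      (fun t ht => by simp [hh, hχσ t ht]) 1 hσ1.le
    have step4 : ∑ l ∈ Finset.range d, ((0 + l).choose 0 : ℝ) * n.choose (0 + l) *
        σ ^ (n - (0 + l)) * (1 - σ) ^ l =
        ∑ i ∈ Finset.range d, (n.choose i : ℝ) * (1 - σ) ^ i * σ ^ (n - i) :=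
      Finset.sum_congr rfl fun l _ => by simp; ring
    linarith
  have hcont : Continuous fun σ : ℝ =>
      ∑ i ∈ Finset.range d, (n.choose i : ℝ) * (1 - σ) ^ i * σ ^ (n - i) := by fun_prop
  have hlim := (hcont.tendsto τ).mono_left (nhdsWithin_le_nhds (s := Set.Ioi τ))
  refine ge_of_tendsto hlim ?_
  filter_upwards [Ioo_mem_nhdsGT hτ1] with σ hσ
  refine le_of_forall_pos_le_add fun η hη => ?_
  have := main σ hσ.1 hσ.2 (η / 2) (by positivity)
  linarith

/-! ### Random convex programs and their optimal points -/

/-- A family of convex constraints `constr z q ≤ 0` on `q : E`, indexed by scenarios `z : Z`, such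
that any finite set of scenarios is feasible. -/
structure ConvexConstraints (Z E : Type*) [TopologicalSpace Z] [NormedAddCommGroup E]
    [NormedSpace ℝ E] where
  constr : Z → E → ℝ
  continuous_constr : Continuous fun zq : Z × E => constr zq.1 zq.2
  convexOn_constr : ∀ z, ConvexOn ℝ univ (constr z)
  exists_feasible : ∀ A : Set Z, A.Finite → ∃ q, ∀ z ∈ A, constr z q ≤ 0

/-- A family of convex constraints together with a strictly convex coercive cost. Every finite
program then has exactly one optimal point. -/
structure ConvexScenario (Z E : Type*) [TopologicalSpace Z] [NormedAddCommGroup E]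
    [NormedSpace ℝ E] extends ConvexConstraints Z E where
  cost : E → ℝ
  continuous_cost : Continuous cost
  strictConvexOn_cost : StrictConvexOn ℝ univ cost
  tendsto_cost : Tendsto cost (cocompact E) atTop

/-- Projections of closed sets along a `σ`-compact factor are `F_σ`. -/
theorem measurableSet_exists_mem_of_isClosed {X E : Type*} [TopologicalSpace X]
    [MeasurableSpace X] [OpensMeasurableSpace X] [TopologicalSpace E] [SigmaCompactSpace E]
    {S : Set (X × E)} (hS : IsClosed S) : MeasurableSet {x | ∃ q, (x, q) ∈ S} := by
  have h : {x | ∃ q, (x, q) ∈ S} =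
      ⋃ r : ℕ, Prod.fst '' ((fun xq : X × compactCovering E r => (xq.1, (xq.2 : E))) ⁻¹' S) := by
    ext x
    simp only [mem_ofPred_eq, mem_iUnion, mem_image, mem_preimage, Prod.exists, exists_and_right,
      exists_eq_right, Subtype.exists]
    constructor
    · rintro ⟨q, hq⟩
      obtain ⟨r, hr⟩ := exists_mem_compactCovering q
      exact ⟨r, q, hr, hq⟩
    · rintro ⟨r, q, _, hq⟩
      exact ⟨q, hq⟩
  rw [h]
  refine MeasurableSet.iUnion fun r => IsClosed.measurableSet ?_
  have : CompactSpace (compactCovering E r) :=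
    isCompact_iff_compactSpace.1 (isCompact_compactCovering E r)
  exact isClosedMap_fst_of_compactSpace _ (hS.preimage (by fun_prop))

theorem range_subtype_eq_image {ι Z : Type*} (I : Finset ι) (x : ι → Z) :
    range (fun i : {i // i ∈ I} => x i) = x '' I := by
  ext z; simp

namespace ConvexConstraints

variable {Z E : Type*} [TopologicalSpace Z] [NormedAddCommGroup E] [NormedSpace ℝ E]

/-- The points satisfying the constraints of all scenarios in `A`. -/
def feasible (S : ConvexConstraints Z E) (A : Set Z) : Set E := {q | ∀ z ∈ A, S.constr z q ≤ 0}

variable {S : ConvexConstraints Z E} {A B : Set Z}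

theorem feasible_anti (h : A ⊆ B) : S.feasible B ⊆ S.feasible A := fun _ hq z hz => hq z (h hz)

theorem convex_feasible (A : Set Z) : Convex ℝ (S.feasible A) := by
  intro p hp q hq a b ha hb hab z hz
  have h := (S.convexOn_constr z).2 (mem_univ p) (mem_univ q) ha hb hab
  have h1 := mul_nonpos_of_nonneg_of_nonpos ha (hp z hz)
  have h2 := mul_nonpos_of_nonneg_of_nonpos hb (hq z hz)
  simp only [smul_eq_mul] at h
  linarith

theorem isClosed_feasible (A : Set Z) : IsClosed (S.feasible A) := by
  have : S.feasible A = ⋂ z ∈ A, {q | S.constr z q ≤ 0} := by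
    ext q; simp [feasible]
  rw [this]
  refine isClosed_biInter fun z _ => isClosed_le ?_ continuous_const
  exact S.continuous_constr.comp (by fun_prop : Continuous fun q : E => (z, q))

end ConvexConstraints

namespace ConvexScenario

open ConvexConstraints

section Deterministic

variable {Z E : Type*} [TopologicalSpace Z] [NormedAddCommGroup E] [NormedSpace ℝ E]
  (S : ConvexScenario Z E)

/-- `p` minimizes the cost subject to the scenarios in `A`. -/
def IsOpt (A : Set Z) (p : E) : Prop := p ∈ S.feasible A ∧ ∀ q ∈ S.feasible A, S.cost p ≤ S.cost q

/-- The optimal point subject to the scenarios in `A`, meaningful when `A` is finite. -/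
noncomputable def opt (A : Set Z) : E := Classical.epsilon (S.IsOpt A)

variable {S} {A B : Set Z} {p q : E}

theorem isOpt_opt (hA : A.Finite) : S.IsOpt A (S.opt A) := by
  refine Classical.epsilon_spec (p := S.IsOpt A) ?_
  obtain ⟨q, hq⟩ := S.exists_feasible A hA
  obtain ⟨p, hp, hmin⟩ := S.continuous_cost.continuousOn.exists_isMinOn'
    (isClosed_feasible A) hq
    (((S.tendsto_cost.eventually_ge_atTop (S.cost q)).filter_mono inf_le_left))
  exact ⟨p, hp, fun q hq => hmin hq⟩

theorem IsOpt.eq (hp : S.IsOpt A p) (hq : S.IsOpt A q) : p = q :=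
  (S.strictConvexOn_cost.subset (subset_univ _) (convex_feasible A)).eq_of_isMinOn
    (fun r hr => hp.2 r hr) (fun r hr => hq.2 r hr) hp.1 hq.1

theorem IsOpt.opt_eq (hA : A.Finite) (hp : S.IsOpt A p) : S.opt A = p := (isOpt_opt hA).eq hp

theorem IsOpt.of_subset (hp : S.IsOpt A p) (h : A ⊆ B) (hpB : p ∈ S.feasible B) : S.IsOpt B p :=
  ⟨hpB, fun q hq => hp.2 q (feasible_anti h hq)⟩

/-- A constraint that is not active at the optimal point can be removed. -/
theorem IsOpt.of_insert {z : Z} (hp : S.IsOpt (insert z A) p) (hz : S.constr z p < 0) :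
    S.IsOpt A p := by
  refine ⟨feasible_anti (subset_insert z A) hp.1, fun q hq => ?_⟩
  by_contra! hlt
  have hpA := feasible_anti (subset_insert z A) hp.1
  have hcont : Continuous fun t : ℝ => S.constr z ((1 - t) • p + t • q) :=
    S.continuous_constr.comp (by fun_prop : Continuous fun t : ℝ => (z, (1 - t) • p + t • q))
  have hev : ∀ᶠ t in 𝓝 (0 : ℝ), S.constr z ((1 - t) • p + t • q) < 0 :=
    hcont.continuousAt.eventually_lt continuousAt_const (by simpa using hz)
  obtain ⟨t, ht, ht0, ht1⟩ := ((hev.filter_mono nhdsWithin_le_nhds).and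
    (Ioo_mem_nhdsGT (zero_lt_one' ℝ))).exists
  have hr : (1 - t) • p + t • q ∈ S.feasible (insert z A) := by
    rintro w (rfl | hw)
    · exact ht.le
    · exact convex_feasible A hpA hq (by linarith) ht0.le (by ring) w hw
  have h1 := hp.2 _ hr
  have h2 := S.strictConvexOn_cost.convexOn.2 (mem_univ p) (mem_univ q)
    (show (0 : ℝ) ≤ 1 - t by linarith) ht0.le (by ring)
  simp only [smul_eq_mul] at h2
  nlinarith

variable (S) in
/-- The families of scenarios none of whose members can be removed without changing the optimal
point. -/
def essential (ι : Type*) : Set (ι → Z) := {y | ∀ k, S.opt (y '' {k}ᶜ) ≠ S.opt (range y)}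

theorem comp_equiv_mem_essential {ι κ : Type*} (e : ι ≃ κ) {y : κ → Z} :
    y ∘ e ∈ S.essential ι ↔ y ∈ S.essential κ := by
  simp only [essential, mem_ofPred_eq, EquivLike.range_comp, image_comp]
  refine e.forall_congr fun k => ?_
  rw [e.image_compl, image_singleton]

/-- Helly's theorem bounds the size of an essential family by the dimension. -/
theorem card_le_finrank_of_mem_essential [FiniteDimensional ℝ E] {ι : Type*} [Fintype ι]
    {y : ι → Z} (hy : y ∈ S.essential ι) : Fintype.card ι ≤ Module.finrank ℝ E := by
  classical
  by_contra! hcard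
  have hfin : (range y).Finite := finite_range y
  have hopt := isOpt_opt (S := S) hfin
  -- the constraint sets together with the set of points better than the optimum
  let G : Option ι → Set E := fun o => o.elim {q | S.cost q < S.cost (S.opt (range y))}
    (fun i => {q | S.constr (y i) q ≤ 0})
  have hG : (⋂ o ∈ (Finset.univ : Finset (Option ι)), G o).Nonempty := by
    refine Convex.helly_theorem' (𝕜 := ℝ) ?_ ?_
    · rintro (_ | i) _
      · simpa [G] using S.strictConvexOn_cost.convexOn.convex_lt (S.cost (S.opt (range y)))
      · simpa [G] using (S.convexOn_constr (y i)).convex_le 0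
    · intro I _ hI
      by_cases hnone : none ∈ I
      · obtain ⟨k, hk⟩ : ∃ k, some k ∉ I := by
          by_contra! hall
          have : I = Finset.univ := by
            ext o
            cases o <;> simp [hnone, hall]
          rw [this, Finset.card_univ, Fintype.card_option] at hI
          omega
        have hk' := isOpt_opt (S := S) (hfin.subset (image_subset_range y {k}ᶜ))
        refine ⟨S.opt (y '' {k}ᶜ), mem_iInter₂.2 ?_⟩
        rintro (_ | i) hi
        · simp only [G, Option.elim_none, mem_ofPred_eq]
          by_contra! hle
          refine hy k (hk'.eq ⟨?_, fun q hq => hle.trans (hk'.2 q hq)⟩)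
          exact feasible_anti (image_subset_range y _) hopt.1
        · have hik : i ≠ k := by rintro rfl; exact hk hi
          exact hk'.1 (y i) (mem_image_of_mem y hik)
      · refine ⟨S.opt (range y), mem_iInter₂.2 ?_⟩
        rintro (_ | i) hi
        · exact absurd hi hnone
        · exact hopt.1 (y i) (mem_range_self i)
  obtain ⟨q, hq⟩ := hG
  simp only [Finset.mem_univ, iInter_true, mem_iInter] at hq
  have hlt : S.cost q < S.cost (S.opt (range y)) := hq none
  have hfeas : q ∈ S.feasible (range y) := by
    rintro _ ⟨i, rfl⟩
    exact hq (some i)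
  exact absurd (hopt.2 q hfeas) (not_le.2 hlt)

variable (S) in
/-- The samples `x` whose program has the subfamily indexed by `I` as a basis: that subfamily is
essential and its optimal point satisfies all the remaining constraints. -/
def basisEvent {ι : Type*} (I : Finset ι) : Set (ι → Z) :=
  {x | (fun i : {i // i ∈ I} => x i) ∈ S.essential {i // i ∈ I} ∧
    ∀ k : {i // i ∉ I}, S.constr (x k) (S.opt (range fun i : {i // i ∈ I} => x i)) ≤ 0}

theorem restrict_mem_essential_iff {ι : Type*} [DecidableEq ι] (I : Finset ι) (x : ι → Z) :
    (fun i : {i // i ∈ I} => x i) ∈ S.essential {i // i ∈ I} ↔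
      ∀ k ∈ I, S.opt (x '' (I.erase k : Finset ι)) ≠ S.opt (x '' I) := by
  have h : ∀ k : {i // i ∈ I}, (fun i : {i // i ∈ I} => x i) '' {k}ᶜ =
      x '' (I.erase k : Finset ι) := by
    intro k
    ext z
    simp only [mem_image, mem_compl_iff, mem_singleton_iff, Subtype.exists, Finset.coe_erase,
      Set.mem_sdiff, Subtype.ext_iff]
    constructor
    · rintro ⟨i, hi, hik, rfl⟩; exact ⟨i, ⟨hi, hik⟩, rfl⟩
    · rintro ⟨i, ⟨hi, hik⟩, rfl⟩; exact ⟨i, hi, hik, rfl⟩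
  simp only [essential, mem_ofPred_eq, range_subtype_eq_image, h, Subtype.forall]

theorem opt_range_eq_of_mem_basisEvent {ι : Type*} [Finite ι] {I : Finset ι} {x : ι → Z}
    (hx : x ∈ S.basisEvent I) :
    S.opt (range x) = S.opt (range fun i : {i // i ∈ I} => x i) := by
  have hsub : range (fun i : {i // i ∈ I} => x i) ⊆ range x := by
    rintro _ ⟨i, rfl⟩; exact mem_range_self _
  have hopt := isOpt_opt (S := S) ((finite_range x).subset hsub)
  refine IsOpt.opt_eq (finite_range x) (hopt.of_subset hsub ?_)
  rintro _ ⟨i, rfl⟩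
  by_cases hi : i ∈ I
  · exact hopt.1 _ ⟨⟨i, hi⟩, rfl⟩
  · exact hx.2 ⟨i, hi⟩

theorem exists_mem_basisEvent {ι : Type*} [Fintype ι] (x : ι → Z) : ∃ I, x ∈ S.basisEvent I := by
  classical
  have hne : (Finset.univ.filter fun I : Finset ι => S.opt (x '' I) = S.opt (range x)).Nonempty :=
    ⟨Finset.univ, by simp⟩
  obtain ⟨I, hI, hmin⟩ := Finset.exists_min_image _ Finset.card hne
  simp only [Finset.mem_filter, Finset.mem_univ, true_and] at hI hmin
  refine ⟨I, (restrict_mem_essential_iff I x).2 fun k hk h => ?_, fun k => ?_⟩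
  · have := hmin (I.erase k) (h.trans hI)
    exact absurd (Finset.card_erase_lt_of_mem hk) (not_lt.2 this)
  · rw [range_subtype_eq_image, hI]
    exact (isOpt_opt (S := S) (finite_range x)).1 _ (mem_range_self _)

/-- When no constraint is active by accident, the basis of a sample is unique: a member of one
basis outside another one would be inactive at the common optimal point, hence removable. -/
theorem basisEvent_unique {ι : Type*} [Fintype ι] {x : ι → Z}
    (hnd : ∀ I : Finset ι, ∀ k : {i // i ∉ I},
      S.constr (x k) (S.opt (range fun i : {i // i ∈ I} => x i)) ≠ 0)
    {I J : Finset ι} (hI : x ∈ S.basisEvent I) (hJ : x ∈ S.basisEvent J) : I = J := by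
  classical
  have key : ∀ {I J : Finset ι}, x ∈ S.basisEvent I → x ∈ S.basisEvent J → J ⊆ I := by
    intro I J hI hJ k hkJ
    by_contra hkI
    have hIJ := (opt_range_eq_of_mem_basisEvent hI).symm.trans (opt_range_eq_of_mem_basisEvent hJ)
    have hlt := lt_of_le_of_ne (hI.2 ⟨k, hkI⟩) (hnd I ⟨k, hkI⟩)
    have hoptJ := isOpt_opt (S := S) (A := x '' J) (J.finite_toSet.image x)
    rw [hIJ, range_subtype_eq_image] at hlt
    have hins : x '' J = insert (x k) (x '' (J.erase k : Finset ι)) := by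
      rw [← image_insert_eq, ← Finset.coe_insert, Finset.insert_erase hkJ]
    refine (restrict_mem_essential_iff J x).1 hJ.1 k hkJ ?_
    refine IsOpt.opt_eq ((J.erase k).finite_toSet.image x) (IsOpt.of_insert (z := x k) ?_ hlt)
    rwa [← hins]
  exact (key hJ hI).antisymm (key hI hJ)

end Deterministic

end ConvexScenario

/-! ### The law of the satisfaction probability -/

namespace ConvexConstraints

variable {Z E : Type*} [TopologicalSpace Z] [MeasurableSpace Z] [NormedAddCommGroup E]
  [NormedSpace ℝ E]

/-- The probability that the point `p` satisfies the constraint of a random scenario. -/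
noncomputable def satProb (S : ConvexConstraints Z E) (μ : Measure Z) (p : E) : ℝ :=
  μ.real {z | S.constr z p ≤ 0}

variable {S : ConvexConstraints Z E} {μ : Measure Z}

theorem satProb_mem_Icc [IsProbabilityMeasure μ] (p : E) : S.satProb μ p ∈ Icc (0 : ℝ) 1 :=
  ⟨measureReal_nonneg, measureReal_le_one⟩

theorem ofReal_satProb [IsFiniteMeasure μ] (p : E) :
    ENNReal.ofReal (S.satProb μ p) = μ {z | S.constr z p ≤ 0} :=
  ofReal_measureReal

variable [BorelSpace Z] [FiniteDimensional ℝ E] [MeasurableSpace E] [BorelSpace E]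

theorem measurableSet_constr_le {X : Type*} [MeasurableSpace X] {u : X → Z} {v : X → E}
    (hu : Measurable u) (hv : Measurable v) : MeasurableSet {x | S.constr (u x) (v x) ≤ 0} := by
  have : ProperSpace E := FiniteDimensional.proper ℝ E
  exact measurableSet_le (S.continuous_constr.measurable.comp (hu.prodMk hv)) measurable_const

theorem measurableSet_constr_eq {X : Type*} [MeasurableSpace X] {u : X → Z} {v : X → E}
    (hu : Measurable u) (hv : Measurable v) : MeasurableSet {x | S.constr (u x) (v x) = 0} := by
  have : ProperSpace E := FiniteDimensional.proper ℝ E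
  exact measurableSet_eq_fun (S.continuous_constr.measurable.comp (hu.prodMk hv))
    measurable_const

theorem measurable_satProb [IsFiniteMeasure μ] : Measurable (S.satProb μ) :=
  (measurable_measure_prodMk_left
    (measurableSet_constr_le (S := S) (X := E × Z) measurable_snd measurable_fst)).ennreal_toReal

end ConvexConstraints

namespace ConvexScenario

open ConvexConstraints

section Law

variable {Z E : Type*} [TopologicalSpace Z] [MeasurableSpace Z] [NormedAddCommGroup E]
  [NormedSpace ℝ E] {S : ConvexScenario Z E} {μ : Measure Z}

variable (S μ) in
/-- The law, carried by the essential families of `i` scenarios, of the satisfaction probability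
of the optimal point. It is in general a sub-probability measure. -/
noncomputable def basisLaw (i : ℕ) : Measure ℝ :=
  ((Measure.pi fun _ : Fin i => μ).restrict (S.essential (Fin i))).map
    fun y => S.satProb μ (S.opt (range y))

theorem basisLaw_eq_zero [FiniteDimensional ℝ E] {i : ℕ} (hi : Module.finrank ℝ E < i) :
    S.basisLaw μ i = 0 := by
  have : S.essential (Fin i) = ∅ := by
    ext y
    simp only [mem_empty_iff_false, iff_false]
    intro hy
    have := card_le_finrank_of_mem_essential hy
    rw [Fintype.card_fin] at this
    omega
  rw [basisLaw, this]
  simp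

end Law

/-! ### Measurability of the optimal point -/

section Random

variable {Z E : Type*} [TopologicalSpace Z] [PolishSpace Z] [MeasurableSpace Z] [BorelSpace Z]
  [NormedAddCommGroup E] [NormedSpace ℝ E] [FiniteDimensional ℝ E] [MeasurableSpace E]
  [BorelSpace E] {S : ConvexScenario Z E}

theorem measurableSet_isOpt_graph {ι : Type*} [Countable ι] :
    MeasurableSet {yp : (ι → Z) × E | S.IsOpt (range yp.1) yp.2} := by
  have : ProperSpace E := FiniteDimensional.proper ℝ E
  have hfeas : ∀ {X : Type _} [TopologicalSpace X] (u : X → ι → Z) (v : X → E), Continuous u →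
      Continuous v → IsClosed {x | v x ∈ S.feasible (range (u x))} := by
    intro X _ u v hu hv
    have : {x | v x ∈ S.feasible (range (u x))} = ⋂ i, {x | S.constr (u x i) (v x) ≤ 0} := by
      ext x; simp [feasible]
    rw [this]
    refine isClosed_iInter fun i => isClosed_le ?_ continuous_const
    exact S.continuous_constr.comp (((continuous_apply i).comp hu).prodMk hv)
  have h : {yp : (ι → Z) × E | S.IsOpt (range yp.1) yp.2} =
      {yp | yp.2 ∈ S.feasible (range yp.1)} \ ⋃ m : ℕ, {yp | ∃ q, (yp, q) ∈
        {ypq : ((ι → Z) × E) × E | ypq.2 ∈ S.feasible (range ypq.1.1)} ∩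
        {ypq | S.cost ypq.2 + 1 / ((m : ℝ) + 1) ≤ S.cost ypq.1.2}} := by
    ext ⟨y, p⟩
    simp only [IsOpt, mem_ofPred_eq, Set.mem_sdiff, mem_iUnion, mem_inter_iff, not_exists, not_and]
    refine and_congr_right fun _ => ⟨fun hopt m q hq hle => ?_, fun hopt q hq => ?_⟩
    · have := hopt q hq
      have : (0 : ℝ) < 1 / ((m : ℝ) + 1) := by positivity
      linarith
    · by_contra! hlt
      obtain ⟨m, hm⟩ := exists_nat_one_div_lt (sub_pos.2 hlt)
      exact hopt m q hq (by linarith)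
  rw [h]
  refine (hfeas _ _ continuous_fst continuous_snd).measurableSet.diff (MeasurableSet.iUnion
    fun m => measurableSet_exists_mem_of_isClosed ((hfeas _ _ (by fun_prop) (by fun_prop)).inter
      (isClosed_le ?_ ?_)))
  · exact (S.continuous_cost.comp continuous_snd).add continuous_const
  · exact S.continuous_cost.comp (by fun_prop)

/-- The optimal point is a function with a Borel graph between standard Borel spaces. -/
theorem measurable_opt_range {ι : Type*} [Finite ι] :
    Measurable fun y : ι → Z => S.opt (range y) := by
  have : ProperSpace E := FiniteDimensional.proper ℝ E
  intro D hD
  have h : (fun y : ι → Z => S.opt (range y)) ⁻¹' D =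
      Prod.fst '' ({yp : (ι → Z) × E | S.IsOpt (range yp.1) yp.2} ∩ {yp | yp.2 ∈ D}) := by
    ext y
    simp only [mem_preimage, mem_image, mem_inter_iff, mem_ofPred_eq, Prod.exists,
      exists_and_right, exists_eq_right]
    constructor
    · exact fun hy => ⟨_, isOpt_opt (finite_range y), hy⟩
    · rintro ⟨p, hp, hpD⟩
      rwa [hp.opt_eq (finite_range y)]
  rw [h]
  refine (measurableSet_isOpt_graph.inter (measurable_snd hD)).image_of_measurable_injOn
    measurable_fst ?_
  rintro ⟨y, p⟩ ⟨hp, _⟩ ⟨y', p'⟩ ⟨hp', _⟩ (rfl : y = y')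
  exact Prod.ext rfl (IsOpt.eq hp hp')

theorem measurableSet_essential {ι : Type*} [Finite ι] : MeasurableSet (S.essential ι) := by
  have : ProperSpace E := FiniteDimensional.proper ℝ E
  have h : S.essential ι = ⋂ k, {y | S.opt (y '' {k}ᶜ) = S.opt (range y)}ᶜ := by
    ext y; simp [essential]
  rw [h]
  refine MeasurableSet.iInter fun k => (measurableSet_eq_fun ?_ measurable_opt_range).compl
  have h2 : (fun y : ι → Z => S.opt (y '' {k}ᶜ)) =
      (fun z : ({k}ᶜ : Set ι) → Z => S.opt (range z)) ∘ fun y i => y i := by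
    funext y
    simp only [Function.comp_apply]
    congr 1
    ext z; simp
  rw [h2]
  exact measurable_opt_range.comp (measurable_pi_lambda _ fun i => measurable_pi_apply _)

variable {μ : Measure Z} [IsProbabilityMeasure μ]

instance (i : ℕ) : IsFiniteMeasure (S.basisLaw μ i) := by
  unfold basisLaw; infer_instance

theorem measurable_satProb_opt_range {ι : Type*} [Finite ι] :
    Measurable fun y : ι → Z => S.satProb μ (S.opt (range y)) :=
  measurable_satProb.comp measurable_opt_range

theorem ae_basisLaw_mem_Icc (i : ℕ) : ∀ᵐ t ∂S.basisLaw μ i, t ∈ Icc (0 : ℝ) 1 := by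
  exact (ae_map_iff (p := fun t => t ∈ Icc (0 : ℝ) 1) measurable_satProb_opt_range.aemeasurable
    measurableSet_Icc).2 (Eventually.of_forall fun y => satProb_mem_Icc _)

/-! ### Decomposition according to the basis -/

/-- Probability of a basis event: given the members of the basis, the other scenarios satisfy the
constraints at its optimal point independently of each other. -/
theorem measure_basisEvent_inter {ι : Type*} [Fintype ι] (I : Finset ι) {B : Set ℝ}
    (hB : MeasurableSet B) :
    Measure.pi (fun _ : ι => μ)
      (S.basisEvent I ∩ {x | S.satProb μ (S.opt (range x)) ∈ B}) =
    ∫⁻ t in B, ENNReal.ofReal t ^ (Fintype.card ι - I.card) ∂S.basisLaw μ I.card := by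
  classical
  let u : ({i // i ∈ I} → Z) → ℝ := fun y => S.satProb μ (S.opt (range y))
  have hu : Measurable u := measurable_satProb_opt_range
  let D : Set ({i // i ∈ I} → Z) := S.essential {i // i ∈ I} ∩ u ⁻¹' B
  have hD : MeasurableSet D := measurableSet_essential.inter (hu hB)
  let G : Set (({i // i ∈ I} → Z) × ({i // i ∉ I} → Z)) :=
    {yz | yz.1 ∈ D ∧ ∀ k, S.constr (yz.2 k) (S.opt (range yz.1)) ≤ 0}
  have hG : MeasurableSet G := by
    have : G = (Prod.fst ⁻¹' D) ∩ ⋂ k,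
        {yz : ({i // i ∈ I} → Z) × ({i // i ∉ I} → Z) |
          S.constr (yz.2 k) (S.opt (range yz.1)) ≤ 0} := by
      ext yz; simp [G]
    rw [this]
    refine (measurable_fst hD).inter (MeasurableSet.iInter fun k => ?_)
    exact measurableSet_constr_le ((measurable_pi_apply k).comp measurable_snd)
      (measurable_opt_range.comp measurable_fst)
  have hpre : S.basisEvent I ∩ {x | S.satProb μ (S.opt (range x)) ∈ B} =
      MeasurableEquiv.piEquivPiSubtypeProd (fun _ : ι => Z) (· ∈ I) ⁻¹' G := by
    ext x
    constructor
    · rintro ⟨hx, hxB⟩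
      refine ⟨⟨hx.1, ?_⟩, hx.2⟩
      rw [mem_ofPred_eq, opt_range_eq_of_mem_basisEvent hx] at hxB
      exact hxB
    · rintro ⟨⟨h1, h2⟩, h3⟩
      have hx : x ∈ S.basisEvent I := ⟨h1, h3⟩
      refine ⟨hx, ?_⟩
      rw [mem_ofPred_eq, opt_range_eq_of_mem_basisEvent hx]
      exact h2
  have hinner : ∀ y, Measure.pi (fun _ : {i // i ∉ I} => μ) (Prod.mk y ⁻¹' G) =
      D.indicator (fun y => ENNReal.ofReal (u y) ^ (Fintype.card ι - I.card)) y := by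
    intro y
    by_cases hy : y ∈ D
    · have : Prod.mk y ⁻¹' G =
          univ.pi fun _ : {i // i ∉ I} => {z | S.constr z (S.opt (range y)) ≤ 0} := by
        ext z; simp [G, hy]
      rw [this, Measure.pi_pi, indicator_of_mem hy, Finset.prod_const, ofReal_satProb]
      simp [Fintype.card_subtype_compl]
    · rw [indicator_of_notMem hy, show Prod.mk y ⁻¹' G = ∅ by ext z; simp [G, hy], measure_empty]
  have hmp : MeasurePreserving (MeasurableEquiv.piEquivPiSubtypeProd (fun _ : ι => Z) (· ∈ I))
      (Measure.pi fun _ => μ) ((Measure.pi fun _ : {i // i ∈ I} => μ).prod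
        (Measure.pi fun _ : {i // i ∉ I} => μ)) := by
    convert measurePreserving_piEquivPiSubtypeProd (fun _ : ι => μ) (· ∈ I)
  rw [hpre, hmp.measure_preimage hG.nullMeasurableSet, Measure.prod_apply hG,
    lintegral_congr hinner]
  -- transport the integral to families indexed by `Fin I.card`
  let e : Fin I.card ≃ {i // i ∈ I} := I.equivFin.symm
  have hmp2 := measurePreserving_piCongrLeft (fun _ : {i // i ∈ I} => μ) e
  have hcomp : ∀ y : Fin I.card → Z,
      (MeasurableEquiv.piCongrLeft (fun _ : {i // i ∈ I} => Z) e y) ∘ e = y := by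
    intro y; funext i
    exact Equiv.piCongrLeft_apply_apply (fun _ : {i // i ∈ I} => Z) e y i
  have hrange : ∀ y : Fin I.card → Z,
      range (MeasurableEquiv.piCongrLeft (fun _ : {i // i ∈ I} => Z) e y) = range y := by
    intro y
    conv_rhs => rw [← hcomp y, EquivLike.range_comp]
  rw [← hmp2.lintegral_comp ((hu.ennreal_ofReal.pow_const _).indicator hD), basisLaw,
    setLIntegral_map hB (by fun_prop) measurable_satProb_opt_range,
    Measure.restrict_restrict (measurable_satProb_opt_range hB),
    ← lintegral_indicator ((measurable_satProb_opt_range hB).inter measurableSet_essential)]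
  refine lintegral_congr fun y => ?_
  have hmem : MeasurableEquiv.piCongrLeft (fun _ : {i // i ∈ I} => Z) e y ∈ D ↔
      y ∈ (fun y : Fin I.card → Z => S.satProb μ (S.opt (range y))) ⁻¹' B ∩
        S.essential (Fin I.card) := by
    have h1 := comp_equiv_mem_essential (S := S) e
      (y := MeasurableEquiv.piCongrLeft (fun _ : {i // i ∈ I} => Z) e y)
    rw [hcomp] at h1
    simp only [D, u, mem_inter_iff, mem_preimage, hrange, ← h1, and_comm]
  by_cases hy : MeasurableEquiv.piCongrLeft (fun _ : {i // i ∈ I} => Z) e y ∈ D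
  · rw [indicator_of_mem hy, indicator_of_mem (hmem.1 hy)]
    simp only [u, hrange]
  · rw [indicator_of_notMem hy, indicator_of_notMem (fun h => hy (hmem.2 h))]

theorem measurableSet_basisEvent {ι : Type*} [Finite ι] (I : Finset ι) :
    MeasurableSet (S.basisEvent I) := by
  have h : S.basisEvent I = (fun x : ι → Z => fun i : {i // i ∈ I} => x i) ⁻¹' S.essential _ ∩
      ⋂ k : {i // i ∉ I},
        {x | S.constr (x k) (S.opt (range fun i : {i // i ∈ I} => x i)) ≤ 0} := by
    ext x; simp [basisEvent]
  have hm : Measurable fun x : ι → Z => fun i : {i // i ∈ I} => x i :=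
    measurable_pi_lambda _ fun i => measurable_pi_apply _
  rw [h]
  exact (hm measurableSet_essential).inter (MeasurableSet.iInter fun k =>
    measurableSet_constr_le (measurable_pi_apply _) (measurable_opt_range.comp hm))

/-- If no fixed point makes a constraint active with positive probability, then almost surely no
scenario outside a subfamily is active at the optimal point of that subfamily. -/
theorem ae_constr_ne_zero (hnd : ∀ p, μ {z | S.constr z p = 0} = 0) {ι : Type*} [Fintype ι] :
    ∀ᵐ x ∂Measure.pi (fun _ : ι => μ), ∀ I : Finset ι, ∀ k : {i // i ∉ I},
      S.constr (x k) (S.opt (range fun i : {i // i ∈ I} => x i)) ≠ 0 := by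
  classical
  rw [ae_all_iff]
  intro I
  rw [ae_all_iff]
  intro k
  have hmp : MeasurePreserving (MeasurableEquiv.piEquivPiSubtypeProd (fun _ : ι => Z) (· ∈ I))
      (Measure.pi fun _ => μ) ((Measure.pi fun _ : {i // i ∈ I} => μ).prod
        (Measure.pi fun _ : {i // i ∉ I} => μ)) := by
    convert measurePreserving_piEquivPiSubtypeProd (fun _ : ι => μ) (· ∈ I)
  have hmeas : MeasurableSet {yz : ({i // i ∈ I} → Z) × ({i // i ∉ I} → Z) |
      S.constr (yz.2 k) (S.opt (range yz.1)) = 0} :=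
    measurableSet_constr_eq ((measurable_pi_apply k).comp measurable_snd)
      (measurable_opt_range.comp measurable_fst)
  have h0 : ((Measure.pi fun _ : {i // i ∈ I} => μ).prod (Measure.pi fun _ : {i // i ∉ I} => μ))
      {yz | S.constr (yz.2 k) (S.opt (range yz.1)) = 0} = 0 := by
    rw [Measure.measure_prod_null hmeas]
    refine Eventually.of_forall fun y => ?_
    have hev := measurePreserving_eval (fun _ : {i // i ∉ I} => μ) k
    have hm2 : MeasurableSet {z | S.constr z (S.opt (range y)) = 0} :=
      measurableSet_constr_eq measurable_id measurable_const
    have := hev.measure_preimage hm2.nullMeasurableSet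
    rw [hnd] at this
    exact this
  have h1 := hmp.measure_preimage hmeas.nullMeasurableSet
  rw [h0] at h1
  rw [ae_iff]
  refine measure_mono_null (fun x hx => ?_) h1
  simpa using hx

/-- The law of the satisfaction probability of the optimal point of a sample, decomposed according
to the basis of the sample. -/
theorem measure_satProb_mem (hnd : ∀ p, μ {z | S.constr z p = 0} = 0) (n : ℕ) {B : Set ℝ}
    (hB : MeasurableSet B) :
    Measure.pi (fun _ : Fin n => μ) {x | S.satProb μ (S.opt (range x)) ∈ B} =
    ∑ i ∈ Finset.range (n + 1),
      (n.choose i : ENNReal) * ∫⁻ t in B, ENNReal.ofReal t ^ (n - i) ∂S.basisLaw μ i := by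
  classical
  have hcover : {x : Fin n → Z | S.satProb μ (S.opt (range x)) ∈ B} =
      ⋃ I ∈ (Finset.univ : Finset (Fin n)).powerset,
        (S.basisEvent I ∩ {x | S.satProb μ (S.opt (range x)) ∈ B}) := by
    ext x
    simp only [mem_ofPred_eq, Finset.powerset_univ, Finset.mem_univ, iUnion_true, mem_iUnion,
      mem_inter_iff, exists_and_right, iff_and_self]
    exact fun _ => exists_mem_basisEvent x
  have hBm : MeasurableSet {x : Fin n → Z | S.satProb μ (S.opt (range x)) ∈ B} :=
    measurable_satProb_opt_range hB
  rw [hcover, measure_biUnion_finset₀]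
  · rw [Finset.sum_congr rfl fun I _ => measure_basisEvent_inter (S := S) (μ := μ) I hB]
    simp only [Fintype.card_fin]
    rw [Finset.sum_powerset_apply_card
      fun i => ∫⁻ t in B, ENNReal.ofReal t ^ (n - i) ∂S.basisLaw μ i]
    simp [nsmul_eq_mul]
  · intro I _ J _ hIJ
    refine measure_mono_null (fun x hx => ?_) (ae_iff.1 (ae_constr_ne_zero (S := S) (μ := μ) hnd))
    exact fun hx' => hIJ (basisEvent_unique hx' hx.1.1 hx.2.1)
  · exact fun I _ => ((measurableSet_basisEvent I).inter hBm).nullMeasurableSet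

theorem real_satProb_mem (hnd : ∀ p, μ {z | S.constr z p = 0} = 0) {n : ℕ}
    (hn : Module.finrank ℝ E ≤ n) {B : Set ℝ} (hB : MeasurableSet B) :
    (Measure.pi fun _ : Fin n => μ).real {x | S.satProb μ (S.opt (range x)) ∈ B} =
    ∑ i ∈ Finset.range (Module.finrank ℝ E + 1),
      (n.choose i : ℝ) * ∫ t in B, t ^ (n - i) ∂S.basisLaw μ i := by
  have hint : ∀ i, ∫ t in B, t ^ (n - i) ∂S.basisLaw μ i =
      (∫⁻ t in B, ENNReal.ofReal t ^ (n - i) ∂S.basisLaw μ i).toReal := by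
    intro i
    have hae : ∀ᵐ t ∂(S.basisLaw μ i).restrict B, t ∈ Icc (0 : ℝ) 1 :=
      ae_restrict_of_ae (ae_basisLaw_mem_Icc i)
    rw [integral_eq_lintegral_of_nonneg_ae (hae.mono fun t ht => pow_nonneg ht.1 _)
      (by fun_prop)]
    congr 1
    exact lintegral_congr_ae (hae.mono fun t ht => ENNReal.ofReal_pow ht.1 _)
  rw [Measure.real, measure_satProb_mem hnd n hB, ENNReal.toReal_sum]
  · simp only [ENNReal.toReal_mul, ENNReal.toReal_natCast, ← hint]
    refine (Finset.sum_subset (Finset.range_mono (by omega)) fun i _ hi => ?_).symm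
    rw [basisLaw_eq_zero (by simpa using hi)]
    simp
  · intro i _
    refine ENNReal.mul_ne_top (ENNReal.natCast_ne_top _) (ne_of_lt ?_)
    refine lt_of_le_of_lt (lintegral_mono_ae (g := fun _ => 1) ?_) (by simp)
    refine (ae_restrict_of_ae (ae_basisLaw_mem_Icc i)).mono fun t ht => ?_
    exact pow_le_one₀ (by positivity) (ENNReal.ofReal_le_one.2 ht.2)

/-- The binomial tail bound for nondegenerate random convex programs. -/
theorem real_satProb_lt_le_of_nondegenerate (hnd : ∀ p, μ {z | S.constr z p = 0} = 0) {n : ℕ}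
    (hn : Module.finrank ℝ E ≤ n) {ε : ℝ} (hε0 : 0 < ε) (hε1 : ε < 1) :
    (Measure.pi fun _ : Fin n => μ).real {x | S.satProb μ (S.opt (range x)) < 1 - ε} ≤
    ∑ i ∈ Finset.range (Module.finrank ℝ E), (n.choose i : ℝ) * ε ^ i * (1 - ε) ^ (n - i) := by
  have hmom : ∀ m, Module.finrank ℝ E ≤ m → ∑ i ∈ Finset.range (Module.finrank ℝ E + 1),
      (m.choose i : ℝ) * ∫ t, t ^ (m - i) ∂S.basisLaw μ i = 1 := by
    intro m hm
    have := real_satProb_mem (S := S) (μ := μ) hnd hm MeasurableSet.univ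
    simpa using this.symm
  have h := sum_choose_mul_setIntegral_le_binomial_tail (τ := 1 - ε) ae_basisLaw_mem_Icc hmom hn
    (by linarith) (by linarith)
  rw [← real_satProb_mem hnd hn measurableSet_Iio] at h
  simpa using h

end Random

end ConvexScenario

/-! ### Limits of programs -/

/-- Fatou's lemma for sets. None of the sets has to be measurable. -/
theorem eventually_lt_measure_of_forall_eventually_mem {X : Type*} [MeasurableSpace X]
    {μ : Measure X} {O : ℕ → Set X} {T : Set X} {a : ENNReal}
    (hT : ∀ x ∈ T, ∀ᶠ m in atTop, x ∈ O m) (ha : a < μ T) : ∀ᶠ m in atTop, a < μ (O m) := by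
  have hmono : Monotone fun m => ⋂ j ≥ m, O j := fun m m' h =>
    biInter_subset_biInter_left fun j hj => le_trans h hj
  have hsub : T ⊆ ⋃ m, ⋂ j ≥ m, O j := fun x hx => by
    obtain ⟨m, hm⟩ := eventually_atTop.1 (hT x hx)
    exact mem_iUnion.2 ⟨m, mem_iInter₂.2 hm⟩
  have h := ha.trans_le (measure_mono hsub)
  rw [hmono.measure_iUnion, lt_iSup_iff] at h
  obtain ⟨m, hm⟩ := h
  filter_upwards [eventually_ge_atTop m] with j hj
  exact hm.trans_le (measure_mono (biInter_subset_of_mem hj))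

theorem measure_le_of_forall_eventually_mem {X : Type*} [MeasurableSpace X]
    {μ : Measure X} {O : ℕ → Set X} {T : Set X} {b : ENNReal}
    (hT : ∀ x ∈ T, ∀ᶠ m in atTop, x ∈ O m) (hb : ∀ m, μ (O m) ≤ b) : μ T ≤ b := by
  by_contra! h
  obtain ⟨m, hm⟩ := (eventually_lt_measure_of_forall_eventually_mem hT h).exists
  exact absurd (hb m) (not_le.2 hm)

/-- A sequence in a compact set converges to `p` if `p` is the only point belonging to all closed
sets that eventually contain the sequence. -/
theorem tendsto_of_forall_isClosed_mem {X : Type*} [TopologicalSpace X] {K : Set X}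
    (hK : IsCompact K) {u : ℕ → X} {p : X} (hu : ∀ m, u m ∈ K)
    (h : ∀ q, (∀ C, IsClosed C → (∀ᶠ m in atTop, u m ∈ C) → q ∈ C) → q = p) :
    Tendsto u atTop (𝓝 p) := by
  refine hK.tendsto_nhds_of_unique_mapClusterPt (Eventually.of_forall hu) fun q _ hq => ?_
  refine h q fun C hC hev => ?_
  by_contra hqC
  obtain ⟨m, h1, h2⟩ := ((mapClusterPt_iff_frequently.1 hq _
    (hC.isOpen_compl.mem_nhds hqC)).and_eventually hev).exists
  exact h1 h2

theorem isCompact_sublevel {E : Type*} [TopologicalSpace E] {f : E → ℝ} (hf : Continuous f)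
    (hlim : Tendsto f (cocompact E) atTop) (a : ℝ) : IsCompact {x | f x ≤ a} := by
  obtain ⟨K, hK, hKf⟩ := mem_cocompact.1 (hlim.eventually_gt_atTop a)
  refine hK.of_isClosed_subset (isClosed_le hf continuous_const) fun x hx => ?_
  by_contra hxK
  exact absurd (show f x ≤ a from hx) (not_le.2 (hKf hxK))

namespace ConvexConstraints

variable {Z E : Type*} [TopologicalSpace Z] [NormedAddCommGroup E] [NormedSpace ℝ E]

theorem continuous_constr_left (S : ConvexConstraints Z E) (p : E) :
    Continuous fun z => S.constr z p :=
  S.continuous_constr.comp (by fun_prop : Continuous fun z : Z => (z, p))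

theorem continuous_constr_right (S : ConvexConstraints Z E) (z : Z) : Continuous (S.constr z) :=
  S.continuous_constr.comp (by fun_prop : Continuous fun p : E => (z, p))

theorem satProb_lt_iff [MeasurableSpace Z] [BorelSpace Z] {S : ConvexConstraints Z E}
    {μ : Measure Z} [IsProbabilityMeasure μ] {ε : ℝ} (hε : 0 ≤ ε) {p : E} :
    S.satProb μ p < 1 - ε ↔ ENNReal.ofReal ε < μ {z | 0 < S.constr z p} := by
  have hm : MeasurableSet {z | S.constr z p ≤ 0} :=
    (isClosed_le (S.continuous_constr_left p) continuous_const).measurableSet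
  have hc : {z | 0 < S.constr z p} = {z | S.constr z p ≤ 0}ᶜ := by
    ext z; simp
  rw [ENNReal.ofReal_lt_iff_lt_toReal hε (measure_ne_top _ _), hc, ← Measure.real,
    probReal_compl_eq_one_sub hm, satProb]
  constructor <;> intro h <;> linarith

theorem eventually_satProb_lt [MeasurableSpace Z] [BorelSpace Z] {S : ConvexConstraints Z E}
    {μ : Measure Z} [IsProbabilityMeasure μ] {ε : ℝ} (hε : 0 ≤ ε) {u : ℕ → E} {p : E}
    (hu : Tendsto u atTop (𝓝 p)) (hp : S.satProb μ p < 1 - ε) :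
    ∀ᶠ m in atTop, S.satProb μ (u m) < 1 - ε := by
  simp only [satProb_lt_iff hε] at hp ⊢
  refine eventually_lt_measure_of_forall_eventually_mem (fun z hz => ?_) hp
  exact (((S.continuous_constr_right z).tendsto p).comp hu).eventually (lt_mem_nhds hz)

end ConvexConstraints

namespace ConvexScenario

open ConvexConstraints

/-! ### Removing the nondegeneracy assumption -/

section Relax

variable {Z E : Type*} [TopologicalSpace Z] [NormedAddCommGroup E] [NormedSpace ℝ E]

/-- The scenario `z` is given a label `s : ℝ`, and its constraint is relaxed by `ρ * |s|`. When
the labels have a law without atoms, the relaxed programs are nondegenerate. -/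
def relax (S : ConvexScenario Z E) (ρ : ℝ) (hρ : 0 ≤ ρ) : ConvexScenario (Z × ℝ) E where
  constr zs q := S.constr zs.1 q - ρ * |zs.2|
  continuous_constr := by
    have := S.continuous_constr.comp
      (by fun_prop : Continuous fun x : (Z × ℝ) × E => (x.1.1, x.2))
    exact this.sub (by fun_prop)
  convexOn_constr zs := (S.convexOn_constr zs.1).sub (concaveOn_const _ convex_univ)
  exists_feasible A hA := by
    obtain ⟨q, hq⟩ := S.exists_feasible (Prod.fst '' A) (hA.image _)
    refine ⟨q, fun z hz => ?_⟩
    have h1 := hq z.1 (mem_image_of_mem _ hz)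
    have h2 : 0 ≤ ρ * |z.2| := by positivity
    linarith
  cost := S.cost
  continuous_cost := S.continuous_cost
  strictConvexOn_cost := S.strictConvexOn_cost
  tendsto_cost := S.tendsto_cost

theorem measure_relax_constr_eq_zero [MeasurableSpace Z] [BorelSpace Z] [FiniteDimensional ℝ E]
    (S : ConvexScenario Z E) {ρ : ℝ} (hρ : 0 < ρ) (μ : Measure Z) [SFinite μ] (ν : Measure ℝ)
    [SFinite ν] [NullSingletonClass ν] (p : E) :
    (μ.prod ν) {z | (S.relax ρ hρ.le).constr z p = 0} = 0 := by
  have hm : MeasurableSet {z | (S.relax ρ hρ.le).constr z p = 0} :=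
    (isClosed_eq ((S.relax ρ hρ.le).continuous_constr_left p) continuous_const).measurableSet
  rw [Measure.measure_prod_null hm]
  refine Eventually.of_forall fun z => ?_
  refine measure_mono_null (t := {S.constr z p / ρ, -(S.constr z p / ρ)}) (fun s hs => ?_)
    ((toFinite _).measure_zero ν)
  have h : S.constr z p - ρ * |s| = 0 := hs
  have h1 : |s| = S.constr z p / ρ := by field_simp; linarith
  rcases abs_choice s with h2 | h2
  · left; rw [← h1, h2]
  · right; rw [mem_singleton_iff, ← h1, h2, neg_neg]

theorem tendsto_opt_relax (S : ConvexScenario Z E) {ι : Type*} [Finite ι] (x : ι → Z × ℝ) :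
    Tendsto (fun m : ℕ => (S.relax (1 / ((m : ℝ) + 1)) (by positivity)).opt (range x)) atTop
      (𝓝 (S.opt (range fun k => (x k).1))) := by
  set p := S.opt (range fun k => (x k).1) with hp
  have hpopt : S.IsOpt (range fun k => (x k).1) p := isOpt_opt (finite_range _)
  have hm : ∀ m : ℕ, (S.relax (1 / ((m : ℝ) + 1)) (by positivity)).IsOpt (range x)
      ((S.relax (1 / ((m : ℝ) + 1)) (by positivity)).opt (range x)) :=
    fun m => isOpt_opt (finite_range x)
  have hcost : ∀ m : ℕ,
      S.cost ((S.relax (1 / ((m : ℝ) + 1)) (by positivity)).opt (range x)) ≤ S.cost p := by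
    intro m
    refine (hm m).2 p ?_
    rintro _ ⟨k, rfl⟩
    have h1 := hpopt.1 _ (mem_range_self k)
    have h2 : 0 ≤ 1 / ((m : ℝ) + 1) * |(x k).2| := by positivity
    change S.constr (x k).1 p - 1 / ((m : ℝ) + 1) * |(x k).2| ≤ 0
    linarith
  refine tendsto_of_forall_isClosed_mem
    (isCompact_sublevel S.continuous_cost S.tendsto_cost (S.cost p)) hcost fun q hq => ?_
  refine IsOpt.eq (S := S) (A := range fun k => (x k).1) ⟨?_, fun r hr => ?_⟩ hpopt
  · rintro _ ⟨k, rfl⟩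
    refine le_of_forall_pos_le_add fun κ hκ => ?_
    refine hq {r | S.constr (x k).1 r ≤ 0 + κ}
      (isClosed_le (S.continuous_constr_right _) continuous_const) ?_
    have hlim : Tendsto (fun m : ℕ => 1 / ((m : ℝ) + 1) * |(x k).2|) atTop (𝓝 (0 * |(x k).2|)) :=
      tendsto_one_div_add_atTop_nhds_zero_nat.mul_const _
    rw [zero_mul] at hlim
    filter_upwards [hlim.eventually (gt_mem_nhds hκ)] with m hmκ
    have h1 : S.constr (x k).1 _ - 1 / ((m : ℝ) + 1) * |(x k).2| ≤ 0 :=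
      (hm m).1 _ (mem_range_self k)
    change S.constr (x k).1 _ ≤ 0 + κ
    linarith
  · exact (hq {r | S.cost r ≤ S.cost p} (isClosed_le S.continuous_cost continuous_const)
      (Eventually.of_forall hcost)).trans (hpopt.2 r hr)

end Relax

/-- The binomial tail bound for random convex programs, without assuming nondegeneracy. -/
theorem measure_satProb_lt_le {Z E : Type*} [TopologicalSpace Z] [PolishSpace Z]
    [MeasurableSpace Z] [BorelSpace Z] [NormedAddCommGroup E] [NormedSpace ℝ E]
    [FiniteDimensional ℝ E] (S : ConvexScenario Z E) (P : Measure Z) [IsProbabilityMeasure P]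
    {n : ℕ} (hn : Module.finrank ℝ E ≤ n) {ε : ℝ} (hε0 : 0 < ε) (hε1 : ε < 1) :
    (Measure.pi fun _ : Fin n => P) {x | S.satProb P (S.opt (range x)) < 1 - ε} ≤
      ENNReal.ofReal (∑ i ∈ Finset.range (Module.finrank ℝ E),
        (n.choose i : ℝ) * ε ^ i * (1 - ε) ^ (n - i)) := by
  borelize E
  let ν : Measure ℝ := volume.restrict (Icc 0 1)
  have hν : IsProbabilityMeasure ν := ⟨by simp [ν]⟩
  have hmp : MeasurePreserving (fun (x : Fin n → Z × ℝ) k => (x k).1)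
      (Measure.pi fun _ => P.prod ν) (Measure.pi fun _ => P) :=
    measurePreserving_pi _ _ fun _ => measurePreserving_fst
  have hmeas : MeasurableSet {x : Fin n → Z | S.satProb P (S.opt (range x)) < 1 - ε} :=
    measurable_satProb_opt_range measurableSet_Iio
  rw [← hmp.measure_preimage hmeas.nullMeasurableSet]
  refine measure_le_of_forall_eventually_mem (O := fun m : ℕ => {x |
    (S.relax (1 / ((m : ℝ) + 1)) (by positivity)).satProb (P.prod ν)
      ((S.relax (1 / ((m : ℝ) + 1)) (by positivity)).opt (range x)) < 1 - ε})
    (fun x hx => ?_) (fun m => ?_)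
  · have hx' : S.satProb P (S.opt (range fun k => (x k).1)) < 1 - ε := hx
    simp only [satProb_lt_iff hε0.le, mem_ofPred_eq] at hx' ⊢
    have hopen : MeasurableSet {z | 0 < S.constr z (S.opt (range fun k => (x k).1))} :=
      (isOpen_lt continuous_const (S.continuous_constr_left _)).measurableSet
    rw [← (measurePreserving_fst (μ := P) (ν := ν)).measure_preimage
      hopen.nullMeasurableSet] at hx'
    refine eventually_lt_measure_of_forall_eventually_mem (fun z hz => ?_) hx'
    have h1 := ((S.continuous_constr_right z.1).tendsto _).comp (S.tendsto_opt_relax x)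
    have h2 := h1.sub ((tendsto_one_div_add_atTop_nhds_zero_nat (𝕜 := ℝ)).mul_const |z.2|)
    rw [zero_mul, sub_zero] at h2
    exact h2.eventually (lt_mem_nhds hz)
  · have h := real_satProb_lt_le_of_nondegenerate
      (S := S.relax (1 / ((m : ℝ) + 1)) (by positivity)) (μ := P.prod ν)
      (fun p => measure_relax_constr_eq_zero S (by positivity) P ν p) hn hε0 hε1
    rw [← ofReal_measureReal]
    exact ENNReal.ofReal_le_ofReal h

end ConvexScenario

/-! ### Two-stage programs -/

section Penalty

variable {E : Type*} [NormedAddCommGroup E] [InnerProductSpace ℝ E] {b : E → ℝ}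

theorem ConvexOn.strictConvexOn_add_norm_sq (hb : ConvexOn ℝ univ b) {η : ℝ} (hη : 0 < η) :
    StrictConvexOn ℝ univ fun x => b x + η * ‖x‖ ^ 2 := by
  refine StrongConvexOn.strictConvexOn (m := 2 * η) ?_ (by positivity)
  rw [strongConvexOn_iff_convex]
  simpa [mul_div_assoc] using hb

variable [FiniteDimensional ℝ E]

theorem ConvexOn.continuous_of_univ (hb : ConvexOn ℝ univ b) : Continuous b :=
  continuousOn_univ.1 (hb.continuousOn isOpen_univ)

/-- A convex function decreases at most linearly, so a quadratic penalty makes it coercive. -/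
theorem ConvexOn.tendsto_add_norm_sq (hb : ConvexOn ℝ univ b) {η : ℝ} (hη : 0 < η) :
    Tendsto (fun x => b x + η * ‖x‖ ^ 2) (cocompact E) atTop := by
  have : ProperSpace E := FiniteDimensional.proper ℝ E
  obtain ⟨C, hC⟩ := (isCompact_closedBall (0 : E) 1).exists_bound_of_continuousOn
    hb.continuous_of_univ.continuousOn
  have hC0 : |b 0| ≤ C := hC 0 (by simp)
  have hlow : ∀ x : E, 1 ≤ ‖x‖ → -(2 * C * ‖x‖) - C ≤ b x := by
    intro x hx
    have hpos : 0 < ‖x‖ := by linarith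
    have h1 : |b (‖x‖⁻¹ • x)| ≤ C := hC _ (by simp [norm_smul, hpos.ne'])
    have h2 := hb.2 (mem_univ x) (mem_univ 0) (inv_nonneg.2 hpos.le)
      (sub_nonneg.2 (inv_le_one_of_one_le₀ hx)) (by ring)
    rw [smul_zero, add_zero] at h2
    simp only [smul_eq_mul] at h2
    have h3 := mul_le_mul_of_nonneg_left h2 hpos.le
    have h4 : ‖x‖ * (‖x‖⁻¹ * b x + (1 - ‖x‖⁻¹) * b 0) = b x + (‖x‖ - 1) * b 0 := by
      field_simp
    rw [h4] at h3
    have h5 := abs_le.1 h1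
    have h6 := abs_le.1 hC0
    nlinarith
  have hnorm := tendsto_norm_cocompact_atTop (E := E)
  have hquad : Tendsto (fun r : ℝ => r * (η * r - 2 * C) - C) atTop atTop := by
    refine tendsto_atTop_add_const_right _ (-C) (Tendsto.atTop_mul_atTop₀ tendsto_id ?_)
    exact tendsto_atTop_add_const_right _ _ (tendsto_id.const_mul_atTop hη)
  refine tendsto_atTop_mono' _ ?_ (hquad.comp hnorm)
  filter_upwards [hnorm.eventually_ge_atTop 1] with x hx
  have := hlow x hx
  simp only [Function.comp_apply]
  nlinarith

end Penalty

namespace ConvexConstraints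

section Lex

variable {Z E : Type*} [TopologicalSpace Z] [NormedAddCommGroup E] [NormedSpace ℝ E]

/-- `p` is the only optimal point of the two-stage program that minimizes first `ℓ` and then, among
the minimizers of `ℓ`, the function `b`. -/
structure IsLexOpt (S : ConvexConstraints Z E) (ℓ b : E → ℝ) (A : Set Z) (p : E) : Prop where
  mem : p ∈ S.feasible A
  le : ∀ q ∈ S.feasible A, ℓ p ≤ ℓ q
  lt : ∀ q ∈ S.feasible A, ℓ q ≤ ℓ p → q ≠ p → b p < b q

end Lex

variable {Z E : Type*} [TopologicalSpace Z] [NormedAddCommGroup E] [InnerProductSpace ℝ E]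
  [FiniteDimensional ℝ E] (S : ConvexConstraints Z E) {ℓ b : E → ℝ} {A : Set Z}

/-- The two-stage program with costs `ℓ` and `b`, approximated by a one-stage program. The
quadratic penalty makes optimal points exist also when the two-stage program has none. -/
noncomputable def penalized (hℓ : ConvexOn ℝ univ ℓ) (hb : ConvexOn ℝ univ b) {η δ : ℝ}
    (hη : 0 < η) (hδ : 0 < δ) : ConvexScenario Z E where
  toConvexConstraints := S
  cost x := (ℓ x + δ * b x) + δ * η * ‖x‖ ^ 2
  continuous_cost := by
    have h1 := hℓ.continuous_of_univ
    have h2 := hb.continuous_of_univ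
    fun_prop
  strictConvexOn_cost :=
    (hℓ.add (hb.smul hδ.le)).strictConvexOn_add_norm_sq (mul_pos hδ hη)
  tendsto_cost := (hℓ.add (hb.smul hδ.le)).tendsto_add_norm_sq (mul_pos hδ hη)

variable {S}

/-- As the weight `δ` of the second cost tends to `0`, the penalized optimal points tend to the
optimal point of the two-stage program with second cost `b + η‖·‖²`. -/
theorem tendsto_opt_penalized (hℓ : ConvexOn ℝ univ ℓ) (hb : ConvexOn ℝ univ b)
    (hA : A.Finite) {η : ℝ} (hη : 0 < η) {p : E}
    (hp : S.IsLexOpt ℓ (fun x => b x + η * ‖x‖ ^ 2) A p) :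
    Tendsto (fun m : ℕ => (S.penalized hℓ hb hη (δ := 1 / ((m : ℝ) + 1)) (by positivity)).opt A)
      atTop (𝓝 p) := by
  set u : ℕ → E := fun m =>
    (S.penalized hℓ hb hη (δ := 1 / ((m : ℝ) + 1)) (by positivity)).opt A with hu
  set c : E → ℝ := fun x => b x + η * ‖x‖ ^ 2 with hc
  have hcc : Continuous c := by
    have := hb.continuous_of_univ
    fun_prop
  have hlim := hb.tendsto_add_norm_sq hη
  have hopt : ∀ m : ℕ, (S.penalized hℓ hb hη (δ := 1 / ((m : ℝ) + 1)) (by positivity)).IsOpt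
      A (u m) :=
    fun m => ConvexScenario.isOpt_opt hA
  have hcmp : ∀ m : ℕ, ℓ (u m) + 1 / ((m : ℝ) + 1) * c (u m) ≤ ℓ p + 1 / ((m : ℝ) + 1) * c p := by
    intro m
    have h : (ℓ (u m) + 1 / ((m : ℝ) + 1) * b (u m)) + 1 / ((m : ℝ) + 1) * η * ‖u m‖ ^ 2 ≤
        (ℓ p + 1 / ((m : ℝ) + 1) * b p) + 1 / ((m : ℝ) + 1) * η * ‖p‖ ^ 2 := (hopt m).2 p hp.mem
    simp only [hc]
    linarith
  have hcu : ∀ m, c (u m) ≤ c p := by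
    intro m
    have h1 := hp.le _ (hopt m).1
    have h2 := hcmp m
    have h3 : 0 < 1 / ((m : ℝ) + 1) := by positivity
    exact le_of_mul_le_mul_left (by linarith) h3
  obtain ⟨x₀, hx₀⟩ := hcc.exists_forall_le' 0 (hlim.eventually_ge_atTop _)
  refine tendsto_of_forall_isClosed_mem (isCompact_sublevel hcc hlim (c p)) hcu fun q hq => ?_
  have hqmem : q ∈ S.feasible A :=
    hq _ (isClosed_feasible A) (Eventually.of_forall fun m => (hopt m).1)
  have hqc : c q ≤ c p :=
    hq {x | c x ≤ c p} (isClosed_le hcc continuous_const) (Eventually.of_forall hcu)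
  have hqℓ : ℓ q ≤ ℓ p := by
    refine le_of_forall_pos_le_add fun κ hκ => ?_
    refine hq {x | ℓ x ≤ ℓ p + κ} (isClosed_le hℓ.continuous_of_univ continuous_const) ?_
    have hlim0 := (tendsto_one_div_add_atTop_nhds_zero_nat (𝕜 := ℝ)).mul_const (c p - c x₀)
    rw [zero_mul] at hlim0
    filter_upwards [hlim0.eventually (gt_mem_nhds hκ)] with m hm
    have h1 := hcmp m
    have h2 : 1 / ((m : ℝ) + 1) * c x₀ ≤ 1 / ((m : ℝ) + 1) * c (u m) :=
      mul_le_mul_of_nonneg_left (hx₀ _) (by positivity)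
    change ℓ (u m) ≤ ℓ p + κ
    linarith
  by_contra hne
  exact absurd hqc (not_le.2 (hp.lt q hqmem hqℓ hne))

/-- If the two-stage program has an optimal point, then so does the one with a quadratic penalty
in the second stage, and as the penalty tends to `0` the optimal points converge. -/
theorem exists_isLexOpt_tendsto (hℓ : ConvexOn ℝ univ ℓ) (hb : ConvexOn ℝ univ b) {p : E}
    (hp : S.IsLexOpt ℓ b A p) :
    ∃ u : ℕ → E, (∀ m : ℕ, S.IsLexOpt ℓ (fun x => b x + 1 / ((m : ℝ) + 1) * ‖x‖ ^ 2) A (u m)) ∧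
      Tendsto u atTop (𝓝 p) := by
  have : ProperSpace E := FiniteDimensional.proper ℝ E
  have hbc := hb.continuous_of_univ
  set M : Set E := S.feasible A ∩ {x | ℓ x ≤ ℓ p} with hM
  have hMconv : Convex ℝ M := (convex_feasible A).inter (by simpa using hℓ.convex_le (ℓ p))
  have hMclosed : IsClosed M :=
    (isClosed_feasible A).inter (isClosed_le hℓ.continuous_of_univ continuous_const)
  have hpM : p ∈ M := ⟨hp.mem, le_refl (ℓ p)⟩
  have hex : ∀ m : ℕ, ∃ x ∈ M, IsMinOn (fun x => b x + 1 / ((m : ℝ) + 1) * ‖x‖ ^ 2) M x := by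
    intro m
    have hm : 0 < 1 / ((m : ℝ) + 1) := by positivity
    refine ContinuousOn.exists_isMinOn' (by fun_prop) hMclosed hpM ?_
    exact ((hb.tendsto_add_norm_sq hm).eventually_ge_atTop _).filter_mono inf_le_left
  choose u huM humin using hex
  refine ⟨u, fun m => ⟨(huM m).1, fun q hq => (huM m).2.trans (hp.le q hq), ?_⟩, ?_⟩
  · intro q hq hqℓ hne
    have hm : 0 < 1 / ((m : ℝ) + 1) := by positivity
    have hqM : q ∈ M := ⟨hq, hqℓ.trans (huM m).2⟩
    by_contra! hle
    refine hne (((hb.strictConvexOn_add_norm_sq hm).subset (subset_univ _)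
      hMconv).eq_of_isMinOn ?_ (humin m) hqM (huM m))
    exact fun r hr => hle.trans (humin m hr)
  have hbp : ∀ x ∈ M, b p ≤ b x := by
    intro x hx
    by_cases hxp : x = p
    · rw [hxp]
    · exact (hp.lt x hx.1 hx.2 hxp).le
  have hcmp : ∀ m : ℕ, b (u m) + 1 / ((m : ℝ) + 1) * ‖u m‖ ^ 2 ≤
      b p + 1 / ((m : ℝ) + 1) * ‖p‖ ^ 2 := fun m => humin m hpM
  have hnorm : ∀ m, u m ∈ Metric.closedBall (0 : E) ‖p‖ := by
    intro m
    rw [mem_closedBall_zero_iff]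
    have h1 := hcmp m
    have h2 := hbp _ (huM m)
    have h3 : 0 < 1 / ((m : ℝ) + 1) := by positivity
    exact le_of_sq_le_sq (le_of_mul_le_mul_left (by linarith) h3) (norm_nonneg _)
  refine tendsto_of_forall_isClosed_mem (isCompact_closedBall (0 : E) ‖p‖) hnorm fun q hq => ?_
  have hqM : q ∈ M := hq _ hMclosed (Eventually.of_forall huM)
  have hqb : b q ≤ b p := by
    refine le_of_forall_pos_le_add fun κ hκ => ?_
    refine hq {x | b x ≤ b p + κ} (isClosed_le hbc continuous_const) ?_
    have hlim0 := (tendsto_one_div_add_atTop_nhds_zero_nat (𝕜 := ℝ)).mul_const (‖p‖ ^ 2)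
    rw [zero_mul] at hlim0
    filter_upwards [hlim0.eventually (gt_mem_nhds hκ)] with m hm
    have h1 := hcmp m
    have h2 : 0 ≤ 1 / ((m : ℝ) + 1) * ‖u m‖ ^ 2 := by positivity
    change b (u m) ≤ b p + κ
    linarith
  by_contra hne
  exact absurd hqb (not_le.2 (hp.lt q hqM.1 hqM.2 hne))

/-- The binomial tail bound for two-stage random convex programs. The set of samples need not be
measurable, and optimal points need not exist for all samples. -/
theorem measure_exists_isLexOpt_satProb_lt_le [PolishSpace Z] [MeasurableSpace Z] [BorelSpace Z]
    (hℓ : ConvexOn ℝ univ ℓ) (hb : ConvexOn ℝ univ b) (P : Measure Z)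
    [IsProbabilityMeasure P] {n : ℕ} (hn : Module.finrank ℝ E ≤ n) {ε : ℝ}
    (hε0 : 0 < ε) (hε1 : ε < 1) :
    (Measure.pi fun _ : Fin n => P)
        {x | ∃ p, S.IsLexOpt ℓ b (range x) p ∧ S.satProb P p < 1 - ε} ≤
      ENNReal.ofReal (∑ i ∈ Finset.range (Module.finrank ℝ E),
        (n.choose i : ℝ) * ε ^ i * (1 - ε) ^ (n - i)) := by
  have hpen : ∀ η > 0, (Measure.pi fun _ : Fin n => P)
      {x | ∃ p, S.IsLexOpt ℓ (fun x => b x + η * ‖x‖ ^ 2) (range x) p ∧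
        S.satProb P p < 1 - ε} ≤
      ENNReal.ofReal (∑ i ∈ Finset.range (Module.finrank ℝ E),
        (n.choose i : ℝ) * ε ^ i * (1 - ε) ^ (n - i)) := by
    intro η hη
    refine measure_le_of_forall_eventually_mem (fun x hx => ?_) (fun m : ℕ =>
      (S.penalized hℓ hb hη (δ := 1 / ((m : ℝ) + 1)) (by positivity)).measure_satProb_lt_le
        P hn hε0 hε1)
    obtain ⟨p, hp, hsat⟩ := hx
    exact eventually_satProb_lt hε0.le
      (tendsto_opt_penalized hℓ hb (finite_range x) hη hp) hsat
  refine measure_le_of_forall_eventually_mem (fun x hx => ?_)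
    (fun m : ℕ => hpen (1 / ((m : ℝ) + 1)) (by positivity))
  obtain ⟨p, hp, hsat⟩ := hx
  obtain ⟨u, hu, hlim⟩ := exists_isLexOpt_tendsto hℓ hb hp
  filter_upwards [eventually_satProb_lt hε0.le hlim hsat] with m hm
  exact ⟨u m, hu m, hm⟩

end ConvexConstraints

/-! ### The control problem -/

namespace PolicyParam

variable {M m nw : ℕ}

theorem input_combo (w : Fin M → Fin nw → ℝ) (x y : PolicyParam M m nw) (a b : ℝ) :
    (a • x + b • y).input w = a • x.input w + b • y.input w := by
  funext t
  simp only [input, Prod.fst_add, Prod.snd_add, Prod.smul_fst, Prod.smul_snd, Pi.add_apply,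
    Pi.smul_apply, Matrix.add_mulVec, Matrix.smul_mulVec, Finset.sum_add_distrib, smul_add,
    Finset.smul_sum]
  abel

theorem continuous_input :
    Continuous fun x : (Fin M → Fin nw → ℝ) × PolicyParam M m nw => x.2.input x.1 := by
  refine continuous_pi fun t => ?_
  have h1 : Continuous fun x : (Fin M → Fin nw → ℝ) × PolicyParam M m nw => x.2.1 t := by fun_prop
  refine h1.add (continuous_finsetSum _ fun τ _ => ?_)
  have h2 : Continuous fun x : (Fin M → Fin nw → ℝ) × PolicyParam M m nw => x.2.2 t τ := by fun_prop
  exact h2.matrix_mulVec (by fun_prop)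

end PolicyParam

namespace ControlProblem

variable {M n m nw pu py : ℕ} (C : ControlProblem M n m nw pu py)

theorem stateAt_combo (w : Fin M → Fin nw → ℝ) (u v : Fin M → Fin m → ℝ) {a b : ℝ}
    (hab : a + b = 1) (t : ℕ) (ht : t ≤ M) :
    C.stateAt (a • u + b • v) w t ht = a • C.stateAt u w t ht + b • C.stateAt v w t ht := by
  induction t with
  | zero => simp only [stateAt]; rw [← add_smul, hab, one_smul]
  | succ t ih =>
    have hw : C.Bw.mulVec (w ⟨t, ht⟩) =
        a • C.Bw.mulVec (w ⟨t, ht⟩) + b • C.Bw.mulVec (w ⟨t, ht⟩) := by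
      rw [← add_smul, hab, one_smul]
    simp only [stateAt, ih, Pi.add_apply, Pi.smul_apply, Matrix.mulVec_add, Matrix.mulVec_smul,
      smul_add]
    nth_rw 1 [hw]
    abel

theorem states_combo (w : Fin M → Fin nw → ℝ) (x y : PolicyParam M m nw) {a b : ℝ}
    (hab : a + b = 1) : C.states w (a • x + b • y) = a • C.states w x + b • C.states w y := by
  funext t
  simp only [states, PolicyParam.input_combo, stateAt_combo C w _ _ hab, Pi.add_apply,
    Pi.smul_apply]

theorem continuous_stateAt (t : ℕ) (ht : t ≤ M) :
    Continuous fun x : (Fin M → Fin nw → ℝ) × PolicyParam M m nw =>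
      C.stateAt (x.2.input x.1) x.1 t ht := by
  induction t with
  | zero => exact continuous_const
  | succ t ih =>
    have h1 := (continuous_apply (⟨t, ht⟩ : Fin M)).comp
      (PolicyParam.continuous_input (M := M) (m := m) (nw := nw))
    have h2 : Continuous fun x : (Fin M → Fin nw → ℝ) × PolicyParam M m nw => x.1 ⟨t, ht⟩ := by
      fun_prop
    exact ((continuous_const.matrix_mulVec (ih _)).add (continuous_const.matrix_mulVec h1)).add
      (continuous_const.matrix_mulVec h2)

theorem continuous_states : Continuous fun x : (Fin M → Fin nw → ℝ) × PolicyParam M m nw =>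
    C.states x.1 x.2 :=
  continuous_pi fun t => C.continuous_stateAt _ t.isLt

/-- The total violation of the componentwise constraints `f ≤ 0`, `g ≤ h` and `0 ≤ h`. -/
noncomputable def violation (w : Fin M → Fin nw → ℝ) (p : PolicyParam M m nw × (Fin py → ℝ)) : ℝ :=
  ∑ i, max (C.f (p.1.input w) i) 0 +
    ∑ j, (max (C.g (C.states w p.1, p.1.input w) j - p.2 j) 0 + max (-p.2 j) 0)

theorem violation_nonpos_iff (w : Fin M → Fin nw → ℝ) (p : PolicyParam M m nw × (Fin py → ℝ)) :
    C.violation w p ≤ 0 ↔ C.Satisfies w p.1 p.2 ∧ 0 ≤ p.2 := by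
  have h1 : 0 ≤ ∑ i, max (C.f (p.1.input w) i) 0 :=
    Finset.sum_nonneg fun i _ => le_max_right _ _
  have h2 : ∀ j ∈ (Finset.univ : Finset (Fin py)),
      0 ≤ max (C.g (C.states w p.1, p.1.input w) j - p.2 j) 0 + max (-p.2 j) 0 :=
    fun j _ => add_nonneg (le_max_right _ _) (le_max_right _ _)
  constructor
  · intro h
    unfold violation at h
    have h3 := Finset.sum_nonneg h2
    have hf := (Finset.sum_eq_zero_iff_of_nonneg
      (fun i _ => le_max_right (C.f (p.1.input w) i) 0)).1 (by linarith)
    have hg := (Finset.sum_eq_zero_iff_of_nonneg h2).1 (by linarith)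
    have hg' : ∀ j, C.g (C.states w p.1, p.1.input w) j - p.2 j ≤ 0 ∧ -p.2 j ≤ 0 := by
      intro j
      have h4 := hg j (Finset.mem_univ j)
      have h5 := le_max_left (C.g (C.states w p.1, p.1.input w) j - p.2 j) 0
      have h6 := le_max_right (C.g (C.states w p.1, p.1.input w) j - p.2 j) 0
      have h7 := le_max_left (-p.2 j) 0
      have h8 := le_max_right (-p.2 j) 0
      constructor <;> linarith
    refine ⟨⟨fun i => ?_, fun j => ?_⟩, fun j => ?_⟩
    · exact (le_max_left _ _).trans (hf i (Finset.mem_univ i)).le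
    · linarith [(hg' j).1]
    · have := (hg' j).2
      change 0 ≤ p.2 j
      linarith
  · rintro ⟨⟨hf, hg⟩, hh⟩
    unfold violation
    rw [Finset.sum_eq_zero fun i _ => max_eq_right (hf i),
      Finset.sum_eq_zero fun j _ => ?_, add_zero]
    have h3 := hg j
    have h4 : 0 ≤ p.2 j := hh j
    rw [max_eq_right (by linarith), max_eq_right (by linarith), add_zero]

variable {C}

theorem continuous_violation (hf : Continuous C.f) (hg : Continuous C.g) :
    Continuous fun x : (Fin M → Fin nw → ℝ) × (PolicyParam M m nw × (Fin py → ℝ)) =>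
      C.violation x.1 x.2 := by
  have hi : Continuous fun x : (Fin M → Fin nw → ℝ) × (PolicyParam M m nw × (Fin py → ℝ)) =>
      x.2.1.input x.1 :=
    PolicyParam.continuous_input.comp (continuous_fst.prodMk (continuous_fst.comp continuous_snd))
  have hs : Continuous fun x : (Fin M → Fin nw → ℝ) × (PolicyParam M m nw × (Fin py → ℝ)) =>
      C.states x.1 x.2.1 :=
    C.continuous_states.comp (continuous_fst.prodMk (continuous_fst.comp continuous_snd))
  have hfi := hf.comp hi
  have hgi := hg.comp (hs.prodMk hi)
  refine (continuous_finsetSum _ fun i _ => ?_).add (continuous_finsetSum _ fun j _ => ?_)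
  · exact ((continuous_apply i).comp hfi).max continuous_const
  · have hh : Continuous fun x : (Fin M → Fin nw → ℝ) × (PolicyParam M m nw × (Fin py → ℝ)) =>
        x.2.2 j := by fun_prop
    exact ((((continuous_apply j).comp hgi).sub hh).max continuous_const).add
      (hh.neg.max continuous_const)

theorem convexOn_violation (hf : ∀ i, ConvexOn ℝ univ fun u => C.f u i)
    (hg : ∀ j, ConvexOn ℝ univ fun xu => C.g xu j) (w : Fin M → Fin nw → ℝ) :
    ConvexOn ℝ univ (C.violation w) := by
  refine ⟨convex_univ, fun x _ y _ a b ha hb hab => ?_⟩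
  have hmax : ∀ {r s t : ℝ}, r ≤ a * s + b * t → max r 0 ≤ a * max s 0 + b * max t 0 := by
    intro r s t h
    have h1 := mul_le_mul_of_nonneg_left (le_max_left s 0) ha
    have h2 := mul_le_mul_of_nonneg_left (le_max_left t 0) hb
    have h3 := mul_nonneg ha (le_max_right s 0)
    have h4 := mul_nonneg hb (le_max_right t 0)
    exact max_le (by linarith) (by linarith)
  simp only [violation, smul_eq_mul, mul_add, Finset.mul_sum, Prod.fst_add, Prod.snd_add,
    Prod.smul_fst, Prod.smul_snd, PolicyParam.input_combo, states_combo C w _ _ hab,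
    Pi.add_apply, Pi.smul_apply]
  have h1 : ∀ i, max (C.f (a • x.1.input w + b • y.1.input w) i) 0 ≤
      a * max (C.f (x.1.input w) i) 0 + b * max (C.f (y.1.input w) i) 0 :=
    fun i => hmax ((hf i).2 (mem_univ _) (mem_univ _) ha hb hab)
  have h2 : ∀ j, max (C.g (a • C.states w x.1 + b • C.states w y.1,
        a • x.1.input w + b • y.1.input w) j - (a * x.2 j + b * y.2 j)) 0 +
        max (-(a * x.2 j + b * y.2 j)) 0 ≤
      (a * max (C.g (C.states w x.1, x.1.input w) j - x.2 j) 0 + a * max (-x.2 j) 0) +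
      (b * max (C.g (C.states w y.1, y.1.input w) j - y.2 j) 0 + b * max (-y.2 j) 0) := by
    intro j
    have h3 := (hg j).2 (mem_univ (C.states w x.1, x.1.input w))
      (mem_univ (C.states w y.1, y.1.input w)) ha hb hab
    simp only [smul_eq_mul, Prod.smul_mk, Prod.mk_add_mk] at h3
    have h4 := hmax (r := C.g (a • C.states w x.1 + b • C.states w y.1,
        a • x.1.input w + b • y.1.input w) j - (a * x.2 j + b * y.2 j))
      (s := C.g (C.states w x.1, x.1.input w) j - x.2 j)
      (t := C.g (C.states w y.1, y.1.input w) j - y.2 j) (by linarith)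
    have h5 := hmax (r := -(a * x.2 j + b * y.2 j)) (s := -x.2 j) (t := -y.2 j) (by linarith)
    linarith
  have h3 := Finset.sum_le_sum fun i (_ : i ∈ (Finset.univ : Finset (Fin pu))) => h1 i
  have h4 := Finset.sum_le_sum fun j (_ : j ∈ (Finset.univ : Finset (Fin py))) => h2 j
  simp only [Finset.sum_add_distrib] at h3 h4 ⊢
  linarith

/-- An input sequence with `f ≤ 0`, applied in open loop, satisfies the input constraints for
every disturbance, and the output constraints can then be met by a large bound `h`. -/
theorem exists_violation_nonpos {u : Fin M → Fin m → ℝ} (hu : C.f u ≤ 0)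
    {A : Set (Fin M → Fin nw → ℝ)} (hA : A.Finite) :
    ∃ p : PolicyParam M m nw × (Fin py → ℝ), ∀ w ∈ A, C.violation w p ≤ 0 := by
  let lam : PolicyParam M m nw := (u, 0)
  have hin : ∀ w, lam.input w = u := by
    intro w; funext t; simp [lam, PolicyParam.input]
  have hbdd : ∀ j, ∃ c, 0 ≤ c ∧ ∀ w ∈ A, C.g (C.states w lam, u) j ≤ c := by
    intro j
    obtain ⟨c, hc⟩ := (hA.image fun w => C.g (C.states w lam, u) j).bddAbove
    exact ⟨max c 0, le_max_right _ _,
      fun w hw => (hc (mem_image_of_mem _ hw)).trans (le_max_left _ _)⟩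
  choose h hh0 hh using hbdd
  refine ⟨(lam, h), fun w hw => (C.violation_nonpos_iff w _).2 ⟨⟨?_, ?_⟩, hh0⟩⟩
  · rw [hin]; exact hu
  · intro j
    simp only [hin]
    exact hh j w hw

/-! ### The scenario cascade as a two-stage program -/

/-- The constraint `0 ≤ h` is repeated in every scenario, so at least one scenario is needed. -/
theorem mem_feasibleOne_iff {N : ℕ} (hN : 0 < N) (ω : Fin N → Fin M → Fin nw → ℝ)
    (p : PolicyParam M m nw × (Fin py → ℝ)) :
    p ∈ C.feasibleOne ω ↔ ∀ k, C.violation (ω k) p ≤ 0 := by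
  simp only [violation_nonpos_iff]
  exact ⟨fun h k => ⟨h.1 k, h.2⟩, fun h => ⟨fun k => (h k).1, (h ⟨0, hN⟩).2⟩⟩

theorem convex_feasibleOne (hf : ∀ i, ConvexOn ℝ univ fun u => C.f u i)
    (hg : ∀ j, ConvexOn ℝ univ fun xu => C.g xu j) {N : ℕ} (hN : 0 < N)
    (ω : Fin N → Fin M → Fin nw → ℝ) : Convex ℝ (C.feasibleOne ω) := by
  have h : C.feasibleOne ω = ⋂ k, {p ∈ univ | C.violation (ω k) p ≤ 0} := by
    ext p
    simp [mem_feasibleOne_iff hN]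
  rw [h]
  exact convex_iInter fun k => (convexOn_violation hf hg (ω k)).convex_le 0

theorem eq_of_isStageOneOptimal (hf : ∀ i, ConvexOn ℝ univ fun u => C.f u i)
    (hg : ∀ j, ConvexOn ℝ univ fun xu => C.g xu j) (hL : StrictConvexOn ℝ univ C.L) {N : ℕ}
    (hN : 0 < N) {ω : Fin N → Fin M → Fin nw → ℝ} {h h' : Fin py → ℝ}
    (hh : C.IsStageOneOptimal ω h) (hh' : C.IsStageOneOptimal ω h') : h = h' := by
  have hconv : Convex ℝ (Prod.snd '' C.feasibleOne ω) :=
    (convex_feasibleOne hf hg hN ω).linear_image (LinearMap.snd ℝ _ _)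
  have hmin : ∀ {h}, C.IsStageOneOptimal ω h → IsMinOn C.L (Prod.snd '' C.feasibleOne ω) h := by
    rintro h ⟨lam, _, hmin⟩ _ ⟨q, hq, rfl⟩
    exact hmin hq
  have hmem : ∀ {h}, C.IsStageOneOptimal ω h → h ∈ Prod.snd '' C.feasibleOne ω := by
    rintro h ⟨lam, hmem, _⟩
    exact ⟨_, hmem, rfl⟩
  exact (hL.subset (subset_univ _) hconv).eq_of_isMinOn (hmin hh) (hmin hh') (hmem hh) (hmem hh')

/-- A cascade solution is feasible, has the least `L`, and the strictly least `J` among the points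
with least `L`. -/
theorem IsCascadeSolution.lex (hf : ∀ i, ConvexOn ℝ univ fun u => C.f u i)
    (hg : ∀ j, ConvexOn ℝ univ fun xu => C.g xu j) (hL : StrictConvexOn ℝ univ C.L)
    (hJ : StrictConvexOn ℝ univ C.J) {N : ℕ} (hN : 0 < N) {ω : Fin N → Fin M → Fin nw → ℝ}
    {p : PolicyParam M m nw × (Fin py → ℝ)} (hp : C.IsCascadeSolution ω p) :
    p ∈ C.feasibleOne ω ∧ (∀ q ∈ C.feasibleOne ω, C.L p.2 ≤ C.L q.2) ∧
      ∀ q ∈ C.feasibleOne ω, C.L q.2 ≤ C.L p.2 → q ≠ p → C.J p.1 < C.J q.1 := by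
  obtain ⟨⟨lam, hlam, hmin⟩, hp2, hpmin⟩ := hp
  have hpmem : p ∈ C.feasibleOne ω := ⟨hp2, hlam.2⟩
  have hle : ∀ q ∈ C.feasibleOne ω, C.L p.2 ≤ C.L q.2 := fun q hq => hmin hq
  refine ⟨hpmem, hle, fun q hq hqL hne => ?_⟩
  have hq2 : q.2 = p.2 := eq_of_isStageOneOptimal hf hg hL hN
    ⟨q.1, hq, fun r hr => hqL.trans (hle r hr)⟩ ⟨p.1, hpmem, fun r hr => hle r hr⟩
  have hqtwo : q.1 ∈ C.feasibleTwo ω p.2 := by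
    rw [← hq2]
    exact hq.1
  have hone : ∀ {lam}, lam ∈ C.feasibleTwo ω p.2 → (lam, p.2) ∈ C.feasibleOne ω :=
    fun h => ⟨h, hlam.2⟩
  have hconv : Convex ℝ (C.feasibleTwo ω p.2) := by
    intro x hx y hy a b ha hb hab
    have := convex_feasibleOne hf hg hN ω (hone hx) (hone hy) ha hb hab
    have h2 := this.1
    simp only [Prod.smul_mk, Prod.mk_add_mk, ← add_smul, hab, one_smul] at h2
    exact h2
  by_contra! hJle
  refine hne (Prod.ext ((hJ.subset (subset_univ _) hconv).eq_of_isMinOn ?_ hpmin hqtwo hp2) hq2)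
  exact fun r hr => hJle.trans (hpmin hr)

theorem subsingleton_isCascadeSolution (hf : ∀ i, ConvexOn ℝ univ fun u => C.f u i)
    (hg : ∀ j, ConvexOn ℝ univ fun xu => C.g xu j) (hL : StrictConvexOn ℝ univ C.L)
    (hJ : StrictConvexOn ℝ univ C.J) {N : ℕ} (hN : 0 < N) (ω : Fin N → Fin M → Fin nw → ℝ) :
    {p | C.IsCascadeSolution ω p}.Subsingleton := by
  intro p hp q hq
  obtain ⟨hp1, hp2, hp3⟩ := IsCascadeSolution.lex hf hg hL hJ hN hp
  obtain ⟨hq1, hq2, hq3⟩ := IsCascadeSolution.lex hf hg hL hJ hN hq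
  by_contra hne
  have h1 := hp3 q hq1 (hq2 p hp1) (Ne.symm hne)
  have h2 := hq3 p hp1 (hp2 q hq1) hne
  exact absurd h1 (not_lt.2 h2.le)

/-- The constraints of the control problem in coordinates `e` of the decision variables. -/
noncomputable def toConvexConstraints (C : ControlProblem M n m nw pu py)
    (hf_cont : Continuous C.f) (hf : ∀ i, ConvexOn ℝ univ fun u => C.f u i)
    (hg_cont : Continuous C.g) (hg : ∀ j, ConvexOn ℝ univ fun xu => C.g xu j)
    {u : Fin M → Fin m → ℝ} (hu : C.f u ≤ 0) {E : Type*} [NormedAddCommGroup E] [NormedSpace ℝ E]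
    (e : E ≃L[ℝ] PolicyParam M m nw × (Fin py → ℝ)) :
    ConvexConstraints (Fin M → Fin nw → ℝ) E where
  constr w q := C.violation w (e q)
  continuous_constr := (continuous_violation hf_cont hg_cont).comp
    (continuous_fst.prodMk (e.continuous.comp continuous_snd))
  convexOn_constr w := by
    have := (convexOn_violation hf hg w).comp_linearMap e.toLinearEquiv.toLinearMap
    simpa [Function.comp_def] using this
  exists_feasible A hA := by
    obtain ⟨p, hp⟩ := exists_violation_nonpos (C := C) hu hA
    exact ⟨e.symm p, fun w hw => by simpa using hp w hw⟩

theorem measure_exists_isCascadeSolution_le (hf_cont : Continuous C.f)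
    (hf : ∀ i, ConvexOn ℝ univ fun u => C.f u i) (hg_cont : Continuous C.g)
    (hg : ∀ j, ConvexOn ℝ univ fun xu => C.g xu j) (hL : StrictConvexOn ℝ univ C.L)
    (hJ : StrictConvexOn ℝ univ C.J) (P : Measure (Fin M → Fin nw → ℝ)) [IsProbabilityMeasure P]
    {ε : ℝ} (hε0 : 0 < ε) (hε1 : ε < 1) {N : ℕ} (hN : 0 < N)
    (hd : Module.finrank ℝ (PolicyParam M m nw × (Fin py → ℝ)) ≤ N) :
    (Measure.pi fun _ : Fin N => P)
        {ω | ∃ p, C.IsCascadeSolution ω p ∧ ¬ C.ChanceConstraint P ε p.1 p.2} ≤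
      ENNReal.ofReal (∑ i ∈ Finset.range
        (Module.finrank ℝ (PolicyParam M m nw × (Fin py → ℝ))),
        (N.choose i : ℝ) * ε ^ i * (1 - ε) ^ (N - i)) := by
  by_cases hex : ∃ u, C.f u ≤ 0
  · obtain ⟨u, hu⟩ := hex
    let E := EuclideanSpace ℝ (Fin (Module.finrank ℝ (PolicyParam M m nw × (Fin py → ℝ))))
    have hdim : Module.finrank ℝ E =
        Module.finrank ℝ (PolicyParam M m nw × (Fin py → ℝ)) := finrank_euclideanSpace_fin
    let e : E ≃L[ℝ] PolicyParam M m nw × (Fin py → ℝ) := ContinuousLinearEquiv.ofFinrankEq hdim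
    let S := C.toConvexConstraints hf_cont hf hg_cont hg hu e
    have hfeas : ∀ (ω : Fin N → Fin M → Fin nw → ℝ) (q : E),
        q ∈ S.feasible (range ω) ↔ e q ∈ C.feasibleOne ω := by
      intro ω q
      rw [mem_feasibleOne_iff hN]
      exact ⟨fun h k => h _ (mem_range_self k), by rintro h _ ⟨k, rfl⟩; exact h k⟩
    have hLe : ConvexOn ℝ univ fun q => C.L (e q).2 := by
      have := hL.convexOn.comp_linearMap ((LinearMap.snd ℝ _ _).comp e.toLinearEquiv.toLinearMap)
      simpa [Function.comp_def] using this
    have hJe : ConvexOn ℝ univ fun q => C.J (e q).1 := by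
      have := hJ.convexOn.comp_linearMap ((LinearMap.fst ℝ _ _).comp e.toLinearEquiv.toLinearMap)
      simpa [Function.comp_def] using this
    have key := S.measure_exists_isLexOpt_satProb_lt_le
      (ℓ := fun q => C.L (e q).2) (b := fun q => C.J (e q).1)
      hLe hJe P (n := N) (by rw [hdim]; exact hd) hε0 hε1
    rw [hdim] at key
    refine (measure_mono ?_).trans key
    rintro ω ⟨p, hp, hviol⟩
    obtain ⟨h1, h2, h3⟩ := IsCascadeSolution.lex hf hg hL hJ hN hp
    refine ⟨e.symm p, ⟨?_, ?_, ?_⟩, ?_⟩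
    · rw [hfeas]; simpa using h1
    · intro q hq
      simpa using h2 (e q) ((hfeas ω q).1 hq)
    · intro q hq hqL hne
      have := h3 (e q) ((hfeas ω q).1 hq) (by simpa using hqL)
        (fun h => hne (by rw [← h]; simp))
      simpa using this
    · rw [ChanceConstraint, not_le] at hviol
      refine lt_of_eq_of_lt ?_ hviol
      have hset : {w | S.constr w (e.symm p) ≤ 0} = {w | C.Satisfies w p.1 p.2} := by
        ext w
        change C.violation w (e (e.symm p)) ≤ 0 ↔ _
        rw [e.apply_symm_apply, violation_nonpos_iff]
        exact ⟨fun h => h.1, fun h => ⟨h, h1.2⟩⟩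
      rw [ConvexConstraints.satProb, hset]
  · have hempty : {ω : Fin N → Fin M → Fin nw → ℝ | ∃ p, C.IsCascadeSolution ω p ∧
        ¬ C.ChanceConstraint P ε p.1 p.2} = ∅ := by
      ext ω
      simp only [mem_ofPred_eq, mem_empty_iff_false, iff_false, not_exists]
      exact fun p hp => hex ⟨_, (hp.1.2.1 ⟨0, hN⟩).1⟩
    rw [hempty, measure_empty]
    exact zero_le

end ControlProblem

/-- When `N < d`, the partial sum contains the whole binomial distribution. -/
theorem one_le_sum_choose_of_lt {N d : ℕ} (h : N < d) {ε : ℝ} (hε0 : 0 ≤ ε) (hε1 : ε ≤ 1) :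
    1 ≤ ∑ i ∈ Finset.range d, (N.choose i : ℝ) * ε ^ i * (1 - ε) ^ (N - i) := by
  have h1 : ∑ i ∈ Finset.range (N + 1), (N.choose i : ℝ) * ε ^ i * (1 - ε) ^ (N - i) = 1 := by
    have := add_pow ε (1 - ε) N
    rw [add_sub_cancel, one_pow] at this
    exact (Finset.sum_congr rfl fun i _ => by ring).trans this.symm
  refine h1.symm.le.trans <|
    Finset.sum_le_sum_of_subset_of_nonneg (Finset.range_mono h) fun i _ _ => ?_
  have := sub_nonneg.2 hε1
  positivity

theorem theorem1 {M n m nw pu py : ℕ} (C : ControlProblem M n m nw pu py)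
    (hf_cont : Continuous C.f) (hf_conv : ∀ i, ConvexOn ℝ Set.univ (fun u => C.f u i))
    (hg_cont : Continuous C.g) (hg_conv : ∀ j, ConvexOn ℝ Set.univ (fun xu => C.g xu j))
    (hL : StrictConvexOn ℝ Set.univ C.L) (hJ : StrictConvexOn ℝ Set.univ C.J)
    (P : Measure (Fin M → Fin nw → ℝ)) [IsProbabilityMeasure P]
    (ε β : ℝ) (hε0 : 0 < ε) (hε1 : ε < 1) (hβ0 : 0 < β) (hβ1 : β < 1)
    (N : ℕ) (hN : 0 < N)
    (hNβ : ∑ i ∈ Finset.range (Module.finrank ℝ (PolicyParam M m nw × (Fin py → ℝ))),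
      (N.choose i : ℝ) * ε ^ i * (1 - ε) ^ (N - i) ≤ β) :
    (∀ ω : Fin N → Fin M → Fin nw → ℝ, {p | C.IsCascadeSolution ω p}.Subsingleton) ∧
    (Measure.pi fun _ : Fin N => P).real
      {ω | ∃ p, C.IsCascadeSolution ω p ∧ ¬ C.ChanceConstraint P ε p.1 p.2} ≤ β ∧
    ((∀ᵐ ω ∂(Measure.pi fun _ : Fin N => P), ∃ p, C.IsCascadeSolution ω p) →
      1 - β ≤ (Measure.pi fun _ : Fin N => P).real
        {ω | ∃ p, C.IsCascadeSolution ω p ∧ C.ChanceConstraint P ε p.1 p.2}) := by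
  have hd : Module.finrank ℝ (PolicyParam M m nw × (Fin py → ℝ)) ≤ N := by
    by_contra! hlt
    have := one_le_sum_choose_of_lt hlt hε0.le hε1.le
    linarith
  have hbad : (Measure.pi fun _ : Fin N => P).real
      {ω | ∃ p, C.IsCascadeSolution ω p ∧ ¬ C.ChanceConstraint P ε p.1 p.2} ≤ β :=
    ENNReal.toReal_le_of_le_ofReal hβ0.le
      ((ControlProblem.measure_exists_isCascadeSolution_le hf_cont hf_conv hg_cont hg_conv hL hJ P
        hε0 hε1 hN hd).trans (ENNReal.ofReal_le_ofReal hNβ))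
  refine ⟨ControlProblem.subsingleton_isCascadeSolution hf_conv hg_conv hL hJ hN, hbad,
    fun hex => ?_⟩
  have hcover : (Measure.pi fun _ : Fin N => P).real
      ({ω | ∃ p, C.IsCascadeSolution ω p ∧ C.ChanceConstraint P ε p.1 p.2} ∪
        {ω | ∃ p, C.IsCascadeSolution ω p ∧ ¬ C.ChanceConstraint P ε p.1 p.2}) = 1 := by
    have hae : ({ω | ∃ p, C.IsCascadeSolution ω p ∧ C.ChanceConstraint P ε p.1 p.2} ∪
        {ω | ∃ p, C.IsCascadeSolution ω p ∧ ¬ C.ChanceConstraint P ε p.1 p.2} :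
        Set (Fin N → Fin M → Fin nw → ℝ)) =ᵐ[Measure.pi fun _ : Fin N => P] Set.univ := by
      rw [Filter.eventuallyEq_univ]
      filter_upwards [hex] with ω ⟨p, hp⟩
      by_cases hc : C.ChanceConstraint P ε p.1 p.2
      · exact Or.inl ⟨p, hp, hc⟩
      · exact Or.inr ⟨p, hp, hc⟩
    rw [measureReal_congr hae]
    simp
  have hunion := measureReal_union_le (μ := Measure.pi fun _ : Fin N => P)
    {ω | ∃ p, C.IsCascadeSolution ω p ∧ C.ChanceConstraint P ε p.1 p.2}
    {ω | ∃ p, C.IsCascadeSolution ω p ∧ ¬ C.ChanceConstraint P ε p.1 p.2}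
  linarith
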